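/- **Definitions.** All graphs are finite, simple and undirected. For a graph $G$ on the vertex set $[n]$ and an integer $q \ge 2$, the storage capacity $\mathrm{Cap}_q(G)$ is the maximum of $\log_q |C|$ over all nonempty codes $C \subseteq [q]^n$ such that for every vertex $i \in [n]$ there is a function that determines $x_i$ from the restriction $x_{N_G(i)}$ of $x$ to the neighborhood of $i$, for all $x \in C$. The parameterized problem Storage Capacity$_q$ asks, for a given graph $G$ and an integer $k \ge 0$ (the parameter), whether $\mathrm{Cap}_q(G) \ge k$. A kernelization algorithm for a parameterized graph problem is an algorithm that, given an instance $(G,k)$, runs in time polynomial in the length of the instance ($G$ given by its adjacency matrix and $k$ in binary) and returns an instance $(G',k')$ that is equivalent to $(G,k)$ (one is a YES instance if and only if the other is), such that the size of $G'$ and $k'$ are both at most $h(k)$ for some computable function $h : \mathbb{N} \to \mathbb{N}$. **Theorem 1.1.** For every integer $q \ge 2$ there exists a (polynomial-time) kernelization algorithm for the Storage Capacity$_q$ problem which, given an instance $(G,k)$, returns an equivalent instance $(G',k')$ such that $G'$ has at most $\max(3k'-3,0)$ vertices and $k' \le k$. -/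

import Mathlib

namespace StorageKernel

/-! ## Storage capacity -/

/-- A code `C ⊆ [q]^V` is a storage code for the graph `G` if for every vertex `i` there is a
recovery function `g` that determines the symbol `x i` of every codeword `x` of `C` from the
restriction of `x` to the neighborhood of `i`. -/
def IsStorageCode {V : Type*} (G : SimpleGraph V) (q : ℕ) (C : Finset (V → Fin q)) : Prop :=
  ∀ i : V, ∃ g : (G.neighborSet i → Fin q) → Fin q,
    ∀ x ∈ C, x i = g (fun j => x (j : V))

/-- The storage capacity `Cap_q(G)`: the maximum of `log_q |C|` over all (nonempty) storage
codes `C ⊆ [q]^V` for `G`. -/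
noncomputable def storageCapacity {V : Type*} (q : ℕ) (G : SimpleGraph V) : ℝ :=
  sSup {r : ℝ | ∃ C : Finset (V → Fin q),
    C.Nonempty ∧ IsStorageCode G q C ∧ r = Real.logb (q : ℝ) (C.card : ℝ)}

/-- For `q ≥ 2` and a finite vertex set the supremum defining the storage capacity is attained,
so it is a maximum. -/
theorem storageCapacity_isGreatest {V : Type*} [Finite V] {q : ℕ} (hq : 2 ≤ q)
    (G : SimpleGraph V) :
    IsGreatest {r : ℝ | ∃ C : Finset (V → Fin q),
      C.Nonempty ∧ IsStorageCode G q C ∧ r = Real.logb (q : ℝ) (C.card : ℝ)}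
      (storageCapacity q G) := by
  have hfin : {r : ℝ | ∃ C : Finset (V → Fin q),
      C.Nonempty ∧ IsStorageCode G q C ∧ r = Real.logb (q : ℝ) (C.card : ℝ)}.Finite := by
    refine (Set.finite_range
      (fun C : Finset (V → Fin q) => Real.logb (q : ℝ) (C.card : ℝ))).subset ?_
    rintro r ⟨C, -, -, rfl⟩
    exact ⟨C, rfl⟩
  refine ⟨Set.Nonempty.csSup_mem ?_ hfin, fun r hr => le_csSup hfin.bddAbove hr⟩
  let z : Fin q := ⟨0, by omega⟩
  refine ⟨_, {fun _ => z}, Finset.singleton_nonempty _, fun i => ⟨fun _ => z, ?_⟩, rfl⟩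
  intro x hx
  rw [Finset.mem_singleton.mp hx]

/-! ## Parameterized graph problems -/

/-- An instance `(G, k)`: a finite simple undirected graph `G` on the vertex set `{0, …, n - 1}`
and a parameter `k ∈ ℕ`. -/
structure GraphInstance where
  /-- The number of vertices. -/
  n : ℕ
  /-- The graph. -/
  graph : SimpleGraph (Fin n)
  /-- The parameter. -/
  k : ℕ

/-- The bit length of the graph of an instance, written as an adjacency matrix. -/
def GraphInstance.graphSize (I : GraphInstance) : ℕ := I.n ^ 2

/-- The bit length of an instance: adjacency matrix, and the parameter in binary. -/
def GraphInstance.size (I : GraphInstance) : ℕ := I.graphSize + Nat.size I.k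

/-- The parameterized problem `Storage Capacity_q`, as the set of its YES instances:
`(G, k)` with `Cap_q(G) ≥ k`. -/
def StorageCapacityProblem (q : ℕ) : Set GraphInstance :=
  {I | (I.k : ℝ) ≤ storageCapacity q I.graph}

/-! ## The machine model

Random access machines with unit cost, written as structured programs. A program can mention
only finitely many registers and arrays. Registers and array cells hold natural numbers. The
arithmetic consists of addition and truncated subtraction only (no multiplication), so within
`t` steps the bit lengths of the numbers grow by at most a summand of order `t`, and polynomial
time on this machine is polynomial time on Turing machines. -/

/-- A memory state: the contents of the registers and of the arrays. -/
@[ext]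
structure State where
  /-- `reg r` is the content of register `r`. -/
  reg : ℕ → ℕ
  /-- `arr a m` is the content of cell `m` of array `a`. -/
  arr : ℕ → ℕ → ℕ

/-- Write the value `v` to register `r`. -/
def State.setReg (s : State) (r v : ℕ) : State :=
  { s with reg := Function.update s.reg r v }

/-- Write the value `v` to cell `m` of array `a`. -/
def State.setArr (s : State) (a m v : ℕ) : State :=
  { s with arr := Function.update s.arr a (Function.update (s.arr a) m v) }

/-- Programs. -/
inductive Prog where
  /-- Do nothing. -/
  | skip : Prog
  /-- `reg r := c` for a literal `c`. -/
  | const (r c : ℕ) : Prog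
  /-- `reg r := reg u + reg v`. -/
  | add (r u v : ℕ) : Prog
  /-- `reg r := reg u - reg v`, truncated at `0`. -/
  | sub (r u v : ℕ) : Prog
  /-- `reg r := arr a (reg u)`. -/
  | load (r a u : ℕ) : Prog
  /-- `arr a (reg u) := reg v`. -/
  | store (a u v : ℕ) : Prog
  /-- First `p`, then `p'`. -/
  | seq (p p' : Prog) : Prog
  /-- If `reg r ≠ 0` then `p` else `p'`. -/
  | ite (r : ℕ) (p p' : Prog) : Prog
  /-- While `reg r ≠ 0` do `p`. -/
  | loop (r : ℕ) (p : Prog) : Prog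

/-- `Exec p s t s'`: started in the state `s`, the program `p` halts in the state `s'` after
exactly `t` steps. Every elementary instruction and every test of a register takes one step. -/
inductive Exec : Prog → State → ℕ → State → Prop
  | skip (s : State) : Exec .skip s 1 s
  | const (r c : ℕ) (s : State) : Exec (.const r c) s 1 (s.setReg r c)
  | add (r u v : ℕ) (s : State) : Exec (.add r u v) s 1 (s.setReg r (s.reg u + s.reg v))
  | sub (r u v : ℕ) (s : State) : Exec (.sub r u v) s 1 (s.setReg r (s.reg u - s.reg v))
  | load (r a u : ℕ) (s : State) : Exec (.load r a u) s 1 (s.setReg r (s.arr a (s.reg u)))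
  | store (a u v : ℕ) (s : State) : Exec (.store a u v) s 1 (s.setArr a (s.reg u) (s.reg v))
  | seq {p p' : Prog} {s s₁ s₂ : State} {t₁ t₂ : ℕ}
      (h₁ : Exec p s t₁ s₁) (h₂ : Exec p' s₁ t₂ s₂) : Exec (.seq p p') s (t₁ + t₂) s₂
  | ite_true {r : ℕ} {p p' : Prog} {s s₁ : State} {t : ℕ}
      (hr : s.reg r ≠ 0) (h : Exec p s t s₁) : Exec (.ite r p p') s (t + 1) s₁
  | ite_false {r : ℕ} {p p' : Prog} {s s₁ : State} {t : ℕ}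
      (hr : s.reg r = 0) (h : Exec p' s t s₁) : Exec (.ite r p p') s (t + 1) s₁
  | loop_stop {r : ℕ} {p : Prog} {s : State}
      (hr : s.reg r = 0) : Exec (.loop r p) s 1 s
  | loop_step {r : ℕ} {p : Prog} {s s₁ s₂ : State} {t₁ t₂ : ℕ}
      (hr : s.reg r ≠ 0) (h₁ : Exec p s t₁ s₁) (h₂ : Exec (.loop r p) s₁ t₂ s₂) :
      Exec (.loop r p) s (t₁ + t₂ + 1) s₂

/-- The machine is deterministic: the number of steps and the final state of a halting run are
determined by the program and the initial state. -/
theorem Exec.deterministic {p : Prog} {s s₁ : State} {t₁ : ℕ} (h : Exec p s t₁ s₁) :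
    ∀ {s₂ : State} {t₂ : ℕ}, Exec p s t₂ s₂ → t₁ = t₂ ∧ s₁ = s₂ := by
  induction h with
  | skip | const | add | sub | load | store =>
    intro s₂ t₂ h'
    cases h'
    exact ⟨rfl, rfl⟩
  | seq _ _ ih₁ ih₂ =>
    intro s₂ t₂ h'
    cases h' with
    | seq k₁ k₂ =>
      obtain ⟨rfl, rfl⟩ := ih₁ k₁
      obtain ⟨rfl, rfl⟩ := ih₂ k₂
      exact ⟨rfl, rfl⟩
  | ite_true hr _ ih =>
    intro s₂ t₂ h'
    cases h' with
    | ite_true _ k =>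
      obtain ⟨rfl, rfl⟩ := ih k
      exact ⟨rfl, rfl⟩
    | ite_false hr' _ => exact absurd hr' hr
  | ite_false hr _ ih =>
    intro s₂ t₂ h'
    cases h' with
    | ite_true hr' _ => exact absurd hr hr'
    | ite_false _ k =>
      obtain ⟨rfl, rfl⟩ := ih k
      exact ⟨rfl, rfl⟩
  | loop_stop hr =>
    intro s₂ t₂ h'
    cases h' with
    | loop_stop _ => exact ⟨rfl, rfl⟩
    | loop_step hr' _ _ => exact absurd hr hr'
  | loop_step hr _ _ ih₁ ih₂ =>
    intro s₂ t₂ h'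
    cases h' with
    | loop_stop hr' => exact absurd hr' hr
    | loop_step _ k₁ k₂ =>
      obtain ⟨rfl, rfl⟩ := ih₁ k₁
      obtain ⟨rfl, rfl⟩ := ih₂ k₂
      exact ⟨rfl, rfl⟩

/-! ## Polynomial-time algorithms and kernelizations -/

open Classical in
/-- The initial state on input `(G, k)`: register `0` holds the number `n` of vertices,
register `1` holds `k`, array `0` holds the adjacency matrix of `G` row by row (the entry of
`i` and `j` in cell `i * n + j`), and all other registers and cells hold `0`. -/
noncomputable def GraphInstance.initState (I : GraphInstance) : State where
  reg r := if r = 0 then I.n else if r = 1 then I.k else 0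
  arr a m := if a = 0 ∧ ∃ i j : Fin I.n, I.graph.Adj i j ∧ m = (i : ℕ) * I.n + (j : ℕ)
    then 1 else 0

open Classical in
/-- The output `(G, k)` can be read off the state `s`, in the same format as the input; the
contents of the other registers and cells do not matter. -/
def State.Represents (s : State) (I : GraphInstance) : Prop :=
  s.reg 0 = I.n ∧ s.reg 1 = I.k ∧
    ∀ i j : Fin I.n, s.arr 0 ((i : ℕ) * I.n + (j : ℕ)) = if I.graph.Adj i j then 1 else 0

/-- The program `P` computes the map `f` on instances in polynomial time: on every input `I` it
halts with the output `f I`, and the number of steps together with the length of the output is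
at most a fixed polynomial in the length of `I`. (The length of the output is counted because a
machine that starts with a blank memory could announce a huge edgeless graph without ever writing
it.) -/
def ComputesInPolyTime (P : Prog) (f : GraphInstance → GraphInstance) : Prop :=
  ∃ T : Polynomial ℕ, ∀ I : GraphInstance, ∃ (t : ℕ) (s : State),
    Exec P I.initState t s ∧ s.Represents (f I) ∧ t + (f I).size ≤ T.eval I.size

/-- The program `P`, computing the map `f` on instances, is a kernelization algorithm for the
parameterized problem `L`: it runs in polynomial time, it maps every instance to an equivalent
one, and both the size of the graph and the parameter of the output are bounded by a computable
function of the parameter of the input. -/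
structure IsKernelization (L : Set GraphInstance) (P : Prog)
    (f : GraphInstance → GraphInstance) : Prop where
  polyTime : ComputesInPolyTime P f
  equivalent : ∀ I : GraphInstance, I ∈ L ↔ f I ∈ L
  bounded : ∃ h : ℕ → ℕ, Computable h ∧
    ∀ I : GraphInstance, (f I).graphSize ≤ h I.k ∧ (f I).k ≤ h I.k

end StorageKernel

namespace StorageKernel

/-! ## Reasoning about programs -/

/-! Take two copies of the vertex set, rows and columns, with row `l` joined to column `r` when `l`
and `r` are adjacent in `G`. A matching algorithm in this bipartite double cover yields vertex sets
`A` (rows) and `B` (columns) such that all neighbors of `A` lie in `B`, every column of `B` is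
matched to a row of `A`, and every row outside `A` is matched (`HallPair`).

Put `H = B \ A`. Vertices of `A \ B` have all their neighbors in `H`, and counting shows that the
matching sends `H` injectively into `A \ B`: this is a crown. Fixing the symbols on `H` determines
those on `A \ B`, while conversely each matched edge can carry a free symbol. Hence the capacity of
`G` is exactly `|H|` plus that of the graph `G'` induced on the vertices in both or in neither of
`A` and `B` (`HallPair.storageCapacity_eq`).

On `G'` the matching becomes a permutation that moves every vertex to a neighbor, so `G'` is spanned
by disjoint edges and cycles and has capacity at least a third of its order, rounded up
(`exists_card_le_three_mul`). With `k' = k - |H|`, either `k' = 0`, or `G'` has more than `3k' - 3`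
vertices, and the answer is YES, or `(G', k')` is small enough to be the output.

The matching comes from an auction. An unmatched row takes its cheapest neighboring column, evicting
the owner and raising the price by one; bidding stops at prices above `n`. Each bid raises the sum
of the prices, which is at most `n(n+1)`, so the auction is polynomial. Among the `n + 1` levels `0,
…, n` some `j` is not a price. An owner pays at most one more than any neighboring price, so no edge
leads from a row paying more than `j` to a column priced below the gap; this gives the sets `A` and
`B` (`Auction.hallPair`).

Running times are handled by a small Hoare logic (`Prog.Reaches`) with syntactic frame conditions.
-/

/-- The final state of a loop-free program. -/
def Prog.run : Prog → State → State
  | .skip, s => s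
  | .const r c, s => s.setReg r c
  | .add r u v, s => s.setReg r (s.reg u + s.reg v)
  | .sub r u v, s => s.setReg r (s.reg u - s.reg v)
  | .load r a u, s => s.setReg r (s.arr a (s.reg u))
  | .store a u v, s => s.setArr a (s.reg u) (s.reg v)
  | .seq p p', s => p'.run (p.run s)
  | .ite r p p', s => if s.reg r = 0 then p'.run s else p.run s
  | .loop _ _, s => s

/-- A bound on the number of steps of a loop-free program. -/
def Prog.cost : Prog → ℕ
  | .seq p p' => p.cost + p'.cost
  | .ite _ p p' => p.cost + p'.cost + 1
  | _ => 1

/-- The program contains no loop. -/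
def Prog.loopFree : Prog → Bool
  | .seq p p' => p.loopFree && p'.loopFree
  | .ite _ p p' => p.loopFree && p'.loopFree
  | .loop _ _ => false
  | _ => true

/-- The registers that a program may write to. -/
def Prog.regs : Prog → List ℕ
  | .const r _ | .add r _ _ | .sub r _ _ | .load r _ _ => [r]
  | .seq p p' | .ite _ p p' => p.regs ++ p'.regs
  | .loop _ p => p.regs
  | _ => []

/-- The arrays that a program may write to. -/
def Prog.arrs : Prog → List ℕ
  | .store a _ _ => [a]
  | .seq p p' | .ite _ p p' => p.arrs ++ p'.arrs
  | .loop _ p => p.arrs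
  | _ => []

/-- The states agree on everything that `p` does not write to. -/
def Prog.Frame (p : Prog) (s s' : State) : Prop :=
  (∀ r, r ∉ p.regs → s'.reg r = s.reg r) ∧ ∀ a, a ∉ p.arrs → s'.arr a = s.arr a

/-- Started in `s`, the program halts within `T` steps in a state satisfying `Q`. -/
def Prog.Reaches (p : Prog) (T : ℕ) (s : State) (Q : State → Prop) : Prop :=
  ∃ t ≤ T, ∃ s', Exec p s t s' ∧ Q s'

/-- The write sets are syntactic, so for concrete programs the preservation of a register or array
reduces to a membership question settled by `decide`. -/
theorem Exec.frame {p : Prog} {s s' : State} {t : ℕ} (h : Exec p s t s') : p.Frame s s' := by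
  induction h with
  | skip | loop_stop => exact ⟨fun _ _ => rfl, fun _ _ => rfl⟩
  | const | add | sub | load =>
    refine ⟨fun r hr => ?_, fun _ _ => rfl⟩
    simp only [Prog.regs, List.mem_singleton] at hr
    simp [State.setReg, hr]
  | store =>
    refine ⟨fun _ _ => rfl, fun a ha => ?_⟩
    simp only [Prog.arrs, List.mem_singleton] at ha
    simp [State.setArr, ha]
  | seq _ _ ih₁ ih₂ =>
    refine ⟨fun r hr => ?_, fun a ha => ?_⟩
    · simp only [Prog.regs, List.mem_append, not_or] at hr
      rw [ih₂.1 r hr.2, ih₁.1 r hr.1]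
    · simp only [Prog.arrs, List.mem_append, not_or] at ha
      rw [ih₂.2 a ha.2, ih₁.2 a ha.1]
  | ite_true _ _ ih =>
    refine ⟨fun r hr => ih.1 r ?_, fun a ha => ih.2 a ?_⟩
    · simp only [Prog.regs, List.mem_append, not_or] at hr
      exact hr.1
    · simp only [Prog.arrs, List.mem_append, not_or] at ha
      exact ha.1
  | ite_false _ _ ih =>
    refine ⟨fun r hr => ih.1 r ?_, fun a ha => ih.2 a ?_⟩
    · simp only [Prog.regs, List.mem_append, not_or] at hr
      exact hr.2
    · simp only [Prog.arrs, List.mem_append, not_or] at ha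
      exact ha.2
  | loop_step _ _ _ ih₁ ih₂ =>
    refine ⟨fun r hr => ?_, fun a ha => ?_⟩
    · rw [ih₂.1 r hr, ih₁.1 r hr]
    · rw [ih₂.2 a ha, ih₁.2 a ha]

theorem Prog.exec_run (p : Prog) (hp : p.loopFree = true) (s : State) :
    ∃ t ≤ p.cost, Exec p s t (p.run s) := by
  induction p generalizing s with
  | loop => simp [Prog.loopFree] at hp
  | skip => exact ⟨1, le_rfl, .skip s⟩
  | const r c => exact ⟨1, le_rfl, .const r c s⟩
  | add r u v => exact ⟨1, le_rfl, .add r u v s⟩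
  | sub r u v => exact ⟨1, le_rfl, .sub r u v s⟩
  | load r a u => exact ⟨1, le_rfl, .load r a u s⟩
  | store a u v => exact ⟨1, le_rfl, .store a u v s⟩
  | seq p p' ih ih' =>
    simp only [Prog.loopFree, Bool.and_eq_true] at hp
    obtain ⟨t, ht, h⟩ := ih hp.1 s
    obtain ⟨t', ht', h'⟩ := ih' hp.2 (p.run s)
    exact ⟨t + t', add_le_add ht ht', h.seq h'⟩
  | ite r p p' ih ih' =>
    simp only [Prog.loopFree, Bool.and_eq_true] at hp
    obtain ⟨t, ht, h⟩ := ih hp.1 s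
    obtain ⟨t', ht', h'⟩ := ih' hp.2 s
    by_cases hr : s.reg r = 0
    · exact ⟨t' + 1, by simp only [Prog.cost]; omega,
        by simpa [Prog.run, hr] using Exec.ite_false hr h'⟩
    · exact ⟨t + 1, by simp only [Prog.cost]; omega,
        by simpa [Prog.run, hr] using Exec.ite_true hr h⟩

theorem Prog.reaches_run {p : Prog} {s : State} {Q : State → Prop} (hp : p.loopFree = true)
    (h : Q (p.run s)) : p.Reaches p.cost s Q :=
  let ⟨t, ht, h'⟩ := p.exec_run hp s
  ⟨t, ht, _, h', h⟩

theorem Prog.Reaches.mono {p : Prog} {T T' : ℕ} {s : State} {Q Q' : State → Prop}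
    (h : p.Reaches T s Q) (hT : T ≤ T') (hQ : ∀ s', p.Frame s s' → Q s' → Q' s') :
    p.Reaches T' s Q' :=
  let ⟨t, ht, s', h', hq⟩ := h
  ⟨t, ht.trans hT, s', h', hQ s' h'.frame hq⟩

theorem Prog.Reaches.seq {p p' : Prog} {T T' : ℕ} {s : State} {Q Q' : State → Prop}
    (h : p.Reaches T s Q) (h' : ∀ s', p.Frame s s' → Q s' → p'.Reaches T' s' Q') :
    (Prog.seq p p').Reaches (T + T') s Q' := by
  obtain ⟨t, ht, s', he, hq⟩ := h
  obtain ⟨t', ht', s'', he', hq'⟩ := h' s' he.frame hq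
  exact ⟨t + t', add_le_add ht ht', s'', he.seq he', hq'⟩

/-- Loops terminate if a measure decreases with every iteration. -/
theorem Prog.reaches_loop {r : ℕ} {p : Prog} {T : ℕ} {s₀ : State} (I : State → Prop)
    (m : State → ℕ)
    (h : ∀ s, p.Frame s₀ s → I s → s.reg r ≠ 0 → p.Reaches T s (fun s' => I s' ∧ m s' < m s))
    (h₀ : I s₀) :
    (Prog.loop r p).Reaches (m s₀ * (T + 1) + 1) s₀ (fun s => I s ∧ s.reg r = 0) := by
  -- The frame stays relative to `s₀`, so that the body may use facts about the start of the loop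
  -- that are not part of the invariant.
  suffices H : ∀ M s, m s ≤ M → p.Frame s₀ s → I s →
      (Prog.loop r p).Reaches (M * (T + 1) + 1) s (fun s => I s ∧ s.reg r = 0) from
    H _ s₀ le_rfl ⟨fun _ _ => rfl, fun _ _ => rfl⟩ h₀
  intro M
  induction M with
  | zero =>
    intro s hm hf hs
    by_cases hr : s.reg r = 0
    · exact ⟨1, by omega, s, Exec.loop_stop hr, hs, hr⟩
    · obtain ⟨_, _, s', _, _, hm'⟩ := h s hf hs hr
      omega
  | succ M ih =>
    intro s hm hf hs
    by_cases hr : s.reg r = 0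
    · exact ⟨1, by omega, s, Exec.loop_stop hr, hs, hr⟩
    · obtain ⟨t, ht, s', he, hs', hm'⟩ := h s hf hs hr
      have hf' := he.frame
      obtain ⟨t', ht', s'', he', hs''⟩ := ih s' (by omega)
        ⟨fun r hr => (hf'.1 r hr).trans (hf.1 r hr), fun a ha => (hf'.2 a ha).trans (hf.2 a ha)⟩
        hs'
      refine ⟨t + t' + 1, ?_, s'', .loop_step hr he he', hs''⟩
      rw [Nat.succ_mul]
      omega

/-- For `c` from `reg b - 1` down to `0` do `p`. Register `2` has to hold `0` and register `3`
has to hold `1`. -/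
def forDown (c b : ℕ) (p : Prog) : Prog :=
  .seq (.add c b 2) (.loop c (.seq (.sub c c 3) p))

/-- `I i` describes the state once the indices `i, …, N - 1` have been treated. Each iteration costs
`T` plus a test and a decrement; the remaining two steps are the initial copy and the last test. The
counter itself serves as the decreasing measure. -/
theorem reaches_forDown {c b N T : ℕ} {p : Prog} {s₀ : State} (I : ℕ → State → Prop)
    (hb : s₀.reg b = N) (h2 : s₀.reg 2 = 0) (h3 : s₀.reg 3 = 1)
    (hI : ∀ i s v, I i s → I i (s.setReg c v))
    (h₀ : I N s₀)
    (h : ∀ i < N, ∀ s, (forDown c b p).Frame s₀ s → s.reg c = i → I (i + 1) s →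
      p.Reaches T s (I i))
    (hc : c ∉ p.regs := by decide) (hc3 : c ≠ 3 := by decide) (h3p : 3 ∉ p.regs := by decide) :
    (forDown c b p).Reaches (N * (T + 2) + 2) s₀ (I 0) := by
  have hrun : (Prog.add c b 2).Reaches 1 s₀ (fun s => I N s ∧ s.reg c = N) :=
    Prog.reaches_run rfl ⟨hI _ _ _ h₀, by simp [Prog.run, State.setReg, hb, h2]⟩
  refine (hrun.seq (T' := N * (T + 2) + 1) (Q' := I 0) fun s hf hs => ?_).mono (by omega)
    fun _ _ h => h
  have hloop := Prog.reaches_loop (r := c) (p := .seq (.sub c c 3) p) (T := T + 1) (s₀ := s)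
    (fun s => s.reg c ≤ N ∧ I (s.reg c) s) (fun s => s.reg c) ?_ ?_
  · refine hloop.mono (by rw [hs.2]) fun s' _ hs' => ?_
    have := hs'.1.2
    rwa [hs'.2] at this
  · rintro s' hf' ⟨hle, hs'⟩ hne
    obtain ⟨i, hi⟩ := Nat.exists_eq_succ_of_ne_zero hne
    rw [hi] at hs' hle ⊢
    have h3' : s'.reg 3 = 1 := by
      rw [hf'.1 3 (by simp [Prog.regs, h3p, hc3.symm]), hf.1 3 (by simp [Prog.regs, hc3.symm]), h3]
    have hsub : (Prog.sub c c 3).Reaches 1 s' (fun s => I (i + 1) s ∧ s.reg c = i) :=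
      Prog.reaches_run rfl ⟨hI _ _ _ hs', by simp [Prog.run, State.setReg, hi, h3']⟩
    refine (hsub.seq (Q' := fun t => I i t ∧ t.reg c = i) fun s'' hf'' hs'' =>
      (h i hle s'' ⟨fun r hr => ?_, fun a ha => ?_⟩ hs''.2 hs''.1).mono le_rfl fun t ht hIt =>
        ⟨hIt, (ht.1 c hc).trans hs''.2⟩).mono (by omega) fun t _ hIt => ?_
    · have : r ≠ c ∧ r ∉ p.regs := by simpa [forDown, Prog.regs] using hr
      rw [hf''.1 r (by simp [Prog.regs, this.1]), hf'.1 r (by simp [Prog.regs, this]),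
        hf.1 r (by simp [Prog.regs, this.1])]
    · have : a ∉ p.arrs := by simpa [forDown, Prog.arrs] using ha
      rw [hf''.2 a (by simp [Prog.arrs]), hf'.2 a (by simp [Prog.arrs, this]),
        hf.2 a (by simp [Prog.arrs])]
    · exact ⟨⟨by omega, by rw [hIt.2]; exact hIt.1⟩, by omega⟩
  · exact ⟨hs.2.le, by rw [hs.2]; exact hs.1⟩

/-! ## Storage capacity and crowns -/

section Capacity

variable {V W : Type*} {q : ℕ}

/-- A recovery function reads the symbol off any codeword that fits the given neighborhood; if none
fits, the value is irrelevant and is set to `0`. -/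
theorem isStorageCode_iff (hq : 2 ≤ q) {G : SimpleGraph V} {C : Finset (V → Fin q)} :
    IsStorageCode G q C ↔
      ∀ i, ∀ x ∈ C, ∀ y ∈ C, (∀ j, G.Adj i j → x j = y j) → x i = y i := by
  classical
  refine forall_congr' fun i => ⟨?_, fun h => ?_⟩
  · rintro ⟨g, hg⟩ x hx y hy hxy
    rw [hg x hx, hg y hy]
    congr 1
    exact funext fun j => hxy j j.2
  · refine ⟨fun u => if hu : ∃ x ∈ C, ∀ j : G.neighborSet i, u j = x j then hu.choose i
      else ⟨0, by omega⟩, fun x hx => ?_⟩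
    have hu : ∃ y ∈ C, ∀ j : G.neighborSet i, x (j : V) = y j := ⟨x, hx, fun _ => rfl⟩
    beta_reduce
    rw [dif_pos hu]
    exact h x hx _ hu.choose_spec.1 fun j hj => hu.choose_spec.2 ⟨j, hj⟩

theorem card_le_of_isStorageCode [Finite V] (hq : 2 ≤ q) {G : SimpleGraph V}
    {C : Finset (V → Fin q)} (hC : IsStorageCode G q C) :
    (C.card : ℝ) ≤ (q : ℝ) ^ storageCapacity q G := by
  have hq1 : (1 : ℝ) < q := by exact_mod_cast hq
  rcases C.eq_empty_or_nonempty with rfl | hne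
  · simp only [Finset.card_empty, Nat.cast_zero]
    positivity
  · rw [← Real.logb_le_iff_le_rpow hq1 (by exact_mod_cast hne.card_pos)]
    exact (storageCapacity_isGreatest hq G).2 ⟨C, hne, hC, rfl⟩

theorem exists_isStorageCode_card [Finite V] (hq : 2 ≤ q) (G : SimpleGraph V) :
    ∃ C : Finset (V → Fin q), IsStorageCode G q C ∧
      (C.card : ℝ) = (q : ℝ) ^ storageCapacity q G := by
  have hq1 : (1 : ℝ) < q := by exact_mod_cast hq
  obtain ⟨C, hne, hC, h⟩ := (storageCapacity_isGreatest hq G).1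
  refine ⟨C, hC, ?_⟩
  rw [h, Real.rpow_logb (by linarith) hq1.ne' (by exact_mod_cast hne.card_pos)]

theorem storageCapacity_nonneg [Finite V] (hq : 2 ≤ q) (G : SimpleGraph V) :
    0 ≤ storageCapacity q G := by
  obtain ⟨C, hne, -, h⟩ := (storageCapacity_isGreatest hq G).1
  rw [h]
  exact Real.logb_nonneg (by exact_mod_cast hq) (by exact_mod_cast hne.card_pos)

/-- A code for an induced subgraph can be combined with a matching outside of it. -/
theorem add_storageCapacity_comap_le [Finite V] [Finite W] (hq : 2 ≤ q) (G : SimpleGraph V)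
    (e : W ↪ V) (H : Finset V) (σ : V → V) (hadj : ∀ v ∈ H, G.Adj v (σ v))
    (hσ : Set.InjOn σ H) (he : ∀ w, e w ∉ H) (heσ : ∀ w, ∀ v ∈ H, e w ≠ σ v)
    (hHσ : ∀ v ∈ H, σ v ∉ H) :
    H.card + storageCapacity q (G.comap e) ≤ storageCapacity q G := by
  classical
  have hq1 : (1 : ℝ) < q := by exact_mod_cast hq
  obtain ⟨D, hD, hcard⟩ := exists_isStorageCode_card hq (G.comap e)
  let z : Fin q := ⟨0, by omega⟩
  -- A codeword on `W` and a free symbol for each matched edge, repeated at both ends `v` and `σ v`;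
  -- all other vertices carry the constant `z`.
  let F : (W → Fin q) × (H → Fin q) → V → Fin q := fun d v =>
    if hv : ∃ w, e w = v then d.1 hv.choose else
      if hv : v ∈ H then d.2 ⟨v, hv⟩ else
        if hv : ∃ u : H, σ u = v then d.2 hv.choose else z
  have hFe : ∀ d w, F d (e w) = d.1 w := by
    intro d w
    have hv : ∃ w', e w' = e w := ⟨w, rfl⟩
    simp only [F]
    rw [dif_pos hv, e.injective hv.choose_spec]
  have hFH : ∀ d (u : H), F d u = d.2 u := by
    intro d u
    simp only [F]
    rw [dif_neg (fun ⟨w, hw⟩ => he w (hw ▸ u.2)), dif_pos u.2]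
  have hFσ : ∀ d (u : H), F d (σ u) = d.2 u := by
    intro d u
    have hv : ∃ u' : H, σ u' = σ u := ⟨u, rfl⟩
    simp only [F]
    rw [dif_neg (fun ⟨w, hw⟩ => heσ w u u.2 hw), dif_neg (hHσ u u.2), dif_pos hv]
    exact congrArg d.2 (Subtype.ext (hσ hv.choose.2 u.2 hv.choose_spec))
  have hFz : ∀ d v, (∀ w, e w ≠ v) → v ∉ H → (∀ u : H, σ u ≠ v) → F d v = z := by
    intro d v h1 h2 h3
    simp only [F]
    rw [dif_neg (by simpa using h1), dif_neg h2, dif_neg (by simpa using h3)]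
  have hinj : Function.Injective F := by
    intro d d' h
    refine Prod.ext (funext fun w => ?_) (funext fun u => ?_)
    · rw [← hFe d w, ← hFe d' w, h]
    · rw [← hFH d u, ← hFH d' u, h]
  have hC : IsStorageCode G q ((D ×ˢ Finset.univ).image F) := by
    rw [isStorageCode_iff hq] at hD ⊢
    intro i x hx y hy hxy
    obtain ⟨d, hd, rfl⟩ := Finset.mem_image.mp hx
    obtain ⟨d', hd', rfl⟩ := Finset.mem_image.mp hy
    by_cases h1 : ∃ w, e w = i
    · obtain ⟨w, rfl⟩ := h1
      rw [hFe, hFe]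
      refine hD w _ (Finset.mem_product.mp hd).1 _ (Finset.mem_product.mp hd').1 fun j hj => ?_
      rw [← hFe d, ← hFe d']
      exact hxy _ hj
    by_cases h2 : i ∈ H
    · rw [hFH d ⟨i, h2⟩, hFH d' ⟨i, h2⟩, ← hFσ d, ← hFσ d']
      exact hxy _ (hadj i h2)
    by_cases h3 : ∃ u : H, σ u = i
    · obtain ⟨u, rfl⟩ := h3
      rw [hFσ, hFσ, ← hFH d, ← hFH d']
      exact hxy _ (hadj u u.2).symm
    push Not at h1 h3
    rw [hFz d i h1 h2 h3, hFz d' i h1 h2 h3]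
  have h := card_le_of_isStorageCode hq hC
  rw [Finset.card_image_of_injective _ hinj, Finset.card_product, Finset.card_univ,
    Fintype.card_fun, Fintype.card_fin, Fintype.card_coe, Nat.cast_mul, hcard, Nat.cast_pow,
    ← Real.rpow_natCast, ← Real.rpow_add (by linarith), Real.rpow_le_rpow_left_iff hq1] at h
  linarith

/-- Removing a set `H` and the vertices all of whose neighbors are in `H` decreases the capacity
by at most `|H|`. -/
theorem storageCapacity_le_add_comap [Finite V] [Finite W] (hq : 2 ≤ q) (G : SimpleGraph V)
    (e : W ↪ V) (H : Finset V)
    (hN : ∀ v, v ∉ H → (∀ w, e w ≠ v) → ∀ u, G.Adj v u → u ∈ H) :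
    storageCapacity q G ≤ H.card + storageCapacity q (G.comap e) := by
  classical
  have hq1 : (1 : ℝ) < q := by exact_mod_cast hq
  obtain ⟨D, hD, hcard⟩ := exists_isStorageCode_card hq G
  rw [isStorageCode_iff hq] at hD
  -- Once the symbols on `H` are fixed, those outside `H` and the range of `e` are determined.
  -- Restriction to `W` is therefore injective on the fiber, and its image is a code for the induced
  -- graph. There are `q ^ |H|` fibers.
  have hfib : ∀ y : H → Fin q,
      (((D.filter fun x => (fun u : H => x u) = y).card : ℕ) : ℝ) ≤
        (q : ℝ) ^ storageCapacity q (G.comap e) := by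
    intro y
    have hiso : ∀ x ∈ D.filter fun x => (fun u : H => x u) = y,
        ∀ x' ∈ D.filter fun x => (fun u : H => x u) = y,
        ∀ v, (∀ w, e w ≠ v) → x v = x' v := by
      intro x hx x' hx' v hv
      rw [Finset.mem_filter] at hx hx'
      have hH : ∀ u ∈ H, x u = x' u := fun u hu => congrFun (hx.2.trans hx'.2.symm) ⟨u, hu⟩
      by_cases hvH : v ∈ H
      · exact hH v hvH
      · exact hD v x hx.1 x' hx'.1 fun u hu => hH u (hN v hvH hv u hu)
    rw [← Finset.card_image_of_injOn (f := fun (x : V → Fin q) (w : W) => x (e w))]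
    · refine card_le_of_isStorageCode hq ((isStorageCode_iff hq).mpr fun w a ha a' ha' h => ?_)
      obtain ⟨x, hx, rfl⟩ := Finset.mem_image.mp ha
      obtain ⟨x', hx', rfl⟩ := Finset.mem_image.mp ha'
      refine hD (e w) x (Finset.mem_filter.mp hx).1 x' (Finset.mem_filter.mp hx').1 fun u hu => ?_
      by_cases hw : ∃ w', e w' = u
      · obtain ⟨w', rfl⟩ := hw
        exact h w' hu
      · push Not at hw
        exact hiso x hx x' hx' u hw
    · intro x hx x' hx' h
      funext v
      by_cases hw : ∃ w', e w' = v
      · obtain ⟨w', rfl⟩ := hw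
        exact congrFun h w'
      · push Not at hw
        exact hiso x hx x' hx' v hw
  have hsum := Finset.card_eq_sum_card_fiberwise (s := D) (t := Finset.univ)
    (f := fun (x : V → Fin q) (u : H) => x u) (fun _ _ => Finset.mem_coe.mpr (Finset.mem_univ _))
  have h : (q : ℝ) ^ storageCapacity q G ≤
      (q : ℝ) ^ ((H.card : ℝ) + storageCapacity q (G.comap e)) := by
    rw [← hcard, hsum, Nat.cast_sum, Real.rpow_add (by linarith)]
    refine (Finset.sum_le_sum fun y _ => hfib y).trans ?_
    rw [Finset.sum_const, Finset.card_univ, Fintype.card_fun, Fintype.card_fin, Fintype.card_coe,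
      nsmul_eq_mul, Nat.cast_pow, Real.rpow_natCast]
  exact (Real.rpow_le_rpow_left_iff hq1).mp h

/-- A graph with a spanning collection of vertex-disjoint edges and cycles has a capacity of at
least a third of the number of its vertices, rounded up. -/
theorem exists_card_le_three_mul [Fintype V] (hq : 2 ≤ q) (G : SimpleGraph V)
    (σ : V → V) (hσ : Function.Injective σ) (hadj : ∀ v, G.Adj v (σ v)) :
    ∃ k : ℕ, Fintype.card V ≤ 3 * k ∧ (k : ℝ) ≤ storageCapacity q G := by
  classical
  -- For a largest `A` disjoint from its image under `σ`, any vertex outside `A`, its image and its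
  -- preimage could be added to `A`. So these three sets, each of size at most `|A|`, cover
  -- everything, and the edges from `A` to its image carry `|A|` free symbols.
  obtain ⟨A, hA, hmax⟩ := Finset.exists_max_image
    (Finset.univ.filter fun A : Finset V => ∀ v ∈ A, σ v ∉ A) Finset.card ⟨∅, by simp⟩
  rw [Finset.mem_filter] at hA
  have hcover : (Finset.univ : Finset V) ⊆ A ∪ A.image σ ∪ A.preimage σ hσ.injOn := by
    intro v _
    by_contra hv
    simp only [Finset.mem_union, Finset.mem_image, Finset.mem_preimage, not_or, not_exists,
      not_and] at hv
    obtain ⟨⟨hvA, hvσ⟩, hσv⟩ := hv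
    have := hmax (insert v A) (by
      simp only [Finset.mem_filter, Finset.mem_univ, true_and, Finset.mem_insert]
      rintro u (rfl | hu)
      · exact not_or.mpr ⟨(hadj u).ne', hσv⟩
      · exact not_or.mpr ⟨hvσ u hu, hA.2 u hu⟩)
    rw [Finset.card_insert_of_notMem hvA] at this
    omega
  have hpre : (A.preimage σ hσ.injOn).card ≤ A.card := by
    rw [Finset.card_preimage]
    exact Finset.card_filter_le _ _
  have h3 : Fintype.card V ≤ 3 * A.card := by
    have := Finset.card_le_card hcover
    have h1 := Finset.card_union_le (A ∪ A.image σ) (A.preimage σ hσ.injOn)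
    have h2 := Finset.card_union_le A (A.image σ)
    have h4 := Finset.card_image_le (s := A) (f := σ)
    rw [Finset.card_univ] at this
    omega
  have h := add_storageCapacity_comap_le hq G (Function.Embedding.ofIsEmpty : Empty ↪ V) A σ
    (fun v _ => hadj v) hσ.injOn (fun w => w.elim) (fun w => w.elim) hA.2
  have h0 := storageCapacity_nonneg hq (G.comap (Function.Embedding.ofIsEmpty : Empty ↪ V))
  exact ⟨A.card, h3, by linarith⟩

/-! ### Hall-type decompositions and the crown they contain -/

/-- The data of a Hall-type decomposition: `own r l` is a partial matching between two copies of
the vertex set, all neighbors of `A` are in `B`, all of `B` is matched to `A`, and everything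
outside `A` is matched. -/
structure HallPair (G : SimpleGraph V) (own : V → V → Prop) (A B : Set V) : Prop where
  adj : ∀ {r l}, own r l → G.Adj l r
  functional : ∀ {r l l'}, own r l → own r l' → l = l'
  injective : ∀ {r r' l}, own r l → own r' l → r = r'
  neighbor : ∀ {l r}, l ∈ A → G.Adj l r → r ∈ B
  owned : ∀ r ∈ B, ∃ l ∈ A, own r l
  matched : ∀ l, l ∉ A → ∃ r, own r l

/-- The owner map is injective on `B` and sends `A ∩ B` into itself, hence onto itself by
finiteness. No owner in `A ∩ B` is left for a vertex of `B \ A`. -/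
theorem HallPair.crown [Finite V] {G : SimpleGraph V} {own : V → V → Prop} {A B : Set V}
    (h : HallPair G own A B) :
    ∃ σ : V → V, (∀ v ∈ B \ A, G.Adj v (σ v)) ∧ Set.InjOn σ (B \ A) ∧
      ∀ v ∈ B \ A, σ v ∈ A \ B := by
  classical
  choose! m hmA hm using h.owned
  have hadj : ∀ v ∈ B, G.Adj v (m v) := fun v hv => (h.adj (hm v hv)).symm
  have hinj : Set.InjOn m B := fun x hx y hy hxy =>
    h.injective (hm x hx) (by rw [hxy]; exact hm y hy)
  have hmaps : Set.MapsTo m (A ∩ B) (A ∩ B) := fun x hx =>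
    ⟨hmA x hx.2, h.neighbor hx.1 (hadj x hx.2)⟩
  have hsurj : Set.SurjOn m (A ∩ B) (A ∩ B) :=
    ((Set.toFinite _).injOn_iff_bijOn_of_mapsTo hmaps).mp (hinj.mono Set.inter_subset_right) |>.surjOn
  refine ⟨m, fun v hv => hadj v hv.1, hinj.mono Set.sdiff_subset, fun v hv =>
    ⟨hmA v hv.1, fun hB => hv.2 ?_⟩⟩
  obtain ⟨x, hx, hxv⟩ := hsurj ⟨hmA v hv.1, hB⟩
  rw [← hinj hx.2 hv.1 hxv]
  exact hx.1

/-- On `A ∩ B` go from a column to its owner, outside `A ∪ B` from a row to its column. Both parts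
are preserved: a row outside `A` whose column lay in `B` would be the owner of that column, and so
in `A`. -/
theorem HallPair.rest [Finite V] {G : SimpleGraph V} {own : V → V → Prop} {A B : Set V}
    (h : HallPair G own A B) :
    ∃ σ : V → V, (∀ v, (v ∈ A ↔ v ∈ B) → G.Adj v (σ v) ∧ (σ v ∈ A ↔ σ v ∈ B)) ∧
      Set.InjOn σ {v | v ∈ A ↔ v ∈ B} := by
  classical
  choose! m hmA hm using h.owned
  choose! g hg using h.matched
  have hmaps : ∀ x, x ∈ A → x ∈ B → m x ∈ A ∧ m x ∈ B := fun x hA hB =>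
    ⟨hmA x hB, h.neighbor hA (h.adj (hm x hB)).symm⟩
  have hgmaps : ∀ x, x ∉ A → x ∉ B → g x ∉ A ∧ g x ∉ B := by
    intro x hA hB
    refine ⟨fun h' => hB (h.neighbor h' (h.adj (hg x hA)).symm), fun h' => hA ?_⟩
    obtain ⟨l, hl, hl'⟩ := h.owned _ h'
    rwa [h.functional (hg x hA) hl']
  refine ⟨fun v => if v ∈ A then m v else g v, fun v hv => ?_, fun x hx y hy hxy => ?_⟩
  · by_cases hA : v ∈ A
    · simp only [hA, if_true]
      have := hmaps v hA (hv.mp hA)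
      exact ⟨(h.adj (hm v (hv.mp hA))).symm, by tauto⟩
    · simp only [hA, if_false]
      have := hgmaps v hA (fun hB => hA (hv.mpr hB))
      exact ⟨h.adj (hg v hA), by tauto⟩
  · simp only [Set.mem_ofPred_eq] at hx hy
    by_cases hxA : x ∈ A <;> by_cases hyA : y ∈ A <;> simp only [hxA, hyA, if_true, if_false] at hxy
    · exact h.injective (hm x (hx.mp hxA)) (by rw [hxy]; exact hm y (hy.mp hyA))
    · exact absurd (hxy ▸ (hmaps x hxA (hx.mp hxA)).1) (hgmaps y hyA (by tauto)).1
    · exact absurd (hxy ▸ (hmaps y hyA (hy.mp hyA)).1) (hgmaps x hxA (by tauto)).1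
    · exact h.functional (hg x hxA) (by rw [hxy]; exact hg y hyA)

theorem HallPair.storageCapacity_eq [Finite V] [Fintype W] (hq : 2 ≤ q) {G : SimpleGraph V}
    {own : V → V → Prop} {A B : Set V} (h : HallPair G own A B) (e : W ↪ V)
    (he : ∀ v, (∃ w, e w = v) ↔ (v ∈ A ↔ v ∈ B)) (H : Finset V)
    (hH : ∀ v, v ∈ H ↔ v ∈ B ∧ v ∉ A) :
    storageCapacity q G = H.card + storageCapacity q (G.comap e) ∧
      ∃ k : ℕ, Fintype.card W ≤ 3 * k ∧ (k : ℝ) ≤ storageCapacity q (G.comap e) := by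
  have hew := fun w => (he (e w)).mp ⟨w, rfl⟩
  refine ⟨le_antisymm ?_ ?_, ?_⟩
  · refine storageCapacity_le_add_comap hq G e H fun v hv hw u hu => ?_
    have h1 : ¬(v ∈ A ↔ v ∈ B) := fun h' => by
      obtain ⟨w, hw'⟩ := (he v).mpr h'
      exact hw w hw'
    rw [hH] at hv ⊢
    have hvA : v ∈ A := by tauto
    exact ⟨h.neighbor hvA hu, fun huA => h1 ⟨fun _ => h.neighbor huA hu.symm, fun _ => hvA⟩⟩
  · obtain ⟨σ, hadj, hinj, hmaps⟩ := h.crown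
    have hmem : ∀ v ∈ H, v ∈ B \ A := fun v hv => (hH v).mp hv
    refine add_storageCapacity_comap_le hq G e H σ (fun v hv => hadj v (hmem v hv))
      (hinj.mono hmem) (fun w hw => ?_) (fun w v hv hw => ?_) (fun v hv hσ => ?_)
    · have := hmem _ hw
      have := hew w
      simp only [Set.mem_sdiff] at *
      tauto
    · have := hmaps v (hmem v hv)
      have := hew w
      rw [← hw] at *
      simp only [Set.mem_sdiff] at *
      tauto
    · have := hmaps v (hmem v hv)
      have := hmem _ hσ
      simp only [Set.mem_sdiff] at *
      tauto
  · obtain ⟨σ, hσ, hinj⟩ := h.rest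
    choose τ hτ using fun w => (he (σ (e w))).mpr (hσ (e w) (hew w)).2
    refine exists_card_le_three_mul hq _ τ (fun w w' hw => e.injective ?_) fun w => ?_
    · refine hinj (hew w) (hew w') ?_
      rw [← hτ, ← hτ, hw]
    · rw [SimpleGraph.comap_adj, hτ]
      exact (hσ (e w) (hew w)).1

end Capacity

/-! ## Auctions -/

/-- The invariants of the bipartite matching auction on the `n × n` matrix `M`, stored row by row:
`p r` is the price of column `r`, `o r = l + 1` if row `l` owns column `r` and `o r = 0` if nobody
does, and `v (l + 1)` is the price of the column owned by row `l`, or `0`. -/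
structure Auction (n : ℕ) (M p o v : ℕ → ℕ) : Prop where
  owner_le : ∀ r < n, o r ≤ n
  price_le : ∀ r < n, p r ≤ n + 1
  price_ne : ∀ r < n, (p r ≠ 0 ↔ o r ≠ 0)
  adj : ∀ r < n, ∀ l, o r = l + 1 → M (l * n + r) ≠ 0
  value : ∀ r < n, ∀ l, o r = l + 1 → v (l + 1) = p r
  slack : ∀ r < n, ∀ l, o r = l + 1 → ∀ r' < n, M (l * n + r') ≠ 0 → p r ≤ p r' + 1
  injective : ∀ r < n, ∀ r' < n, o r ≠ 0 → o r = o r' → r = r'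
  matched : ∀ l < n, v (l + 1) ≠ 0 → ∃ r < n, o r = l + 1

/-- Row `l` has no reason to bid: it owns a column, or all prices are too high. -/
def Settled (n : ℕ) (M p v : ℕ → ℕ) (l : ℕ) : Prop :=
  v (l + 1) ≠ 0 ∨ ∀ r < n, M (l * n + r) ≠ 0 → n < p r

open Function in
-- Slack survives because the column was cheapest for its new owner and other prices do not fall. If
-- the column had no owner, resetting `v (o r)` hits the dummy cell `0`, since rows use the cells `l
-- + 1`.
theorem Auction.bid {n : ℕ} {M p o v : ℕ → ℕ} (h : Auction n M p o v) {l r : ℕ} (hl : l < n)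
    (hv : v (l + 1) = 0) (hr : r < n) (hadj : M (l * n + r) ≠ 0) (hp : p r ≤ n)
    (hmin : ∀ r' < n, M (l * n + r') ≠ 0 → p r ≤ p r') :
    Auction n M (update p r (p r + 1)) (update o r (l + 1))
      (update (update v (o r) 0) (l + 1) (p r + 1)) := by
  -- A row of value `0` owns nothing, since owned columns have nonzero prices.
  have hol : ∀ r' < n, o r' ≠ l + 1 := fun r' hr' ho =>
    (h.price_ne r' hr').mpr (by omega) (by rw [← h.value r' hr' l ho, hv])
  have hp' : ∀ r', p r' ≤ update p r (p r + 1) r' := by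
    intro r'
    rw [update_apply]
    split_ifs with h1
    · subst h1; omega
    · exact le_rfl
  have hne : ∀ r' < n, r' ≠ r → ∀ l', o r' = l' + 1 → l' ≠ l ∧ l' + 1 ≠ o r := by
    refine fun r' hr' hrr l' ho => ⟨?_, fun h' => hrr ?_⟩
    · rintro rfl
      exact hol r' hr' ho
    · exact h.injective r' hr' r hr (by omega) (by omega)
  constructor
  · intro r' hr'
    rw [update_apply]
    split_ifs
    · omega
    · exact h.owner_le r' hr'
  · intro r' hr'
    rw [update_apply]
    split_ifs
    · omega
    · exact h.price_le r' hr'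
  · intro r' hr'
    rw [update_apply, update_apply]
    split_ifs
    · simp
    · exact h.price_ne r' hr'
  · intro r' hr' l' ho
    rw [update_apply] at ho
    split_ifs at ho with h1
    · obtain rfl : l = l' := by omega
      rwa [h1]
    · exact h.adj r' hr' l' ho
  · intro r' hr' l' ho
    by_cases h1 : r' = r
    · subst h1
      rw [update_self] at ho
      rw [← ho, update_self, update_self]
    · rw [update_of_ne h1] at ho
      obtain ⟨h2, h3⟩ := hne r' hr' h1 l' ho
      rw [update_of_ne (by omega), update_of_ne h3, update_of_ne h1, h.value r' hr' l' ho]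
  · intro r' hr' l' ho r'' hr'' hadj'
    by_cases h1 : r' = r
    · subst h1
      rw [update_self] at ho
      obtain rfl : l = l' := by omega
      rw [update_self]
      exact Nat.succ_le_succ ((hmin r'' hr'' hadj').trans (hp' r''))
    · rw [update_of_ne h1] at ho ⊢
      exact (h.slack r' hr' l' ho r'' hr'' hadj').trans (Nat.succ_le_succ (hp' r''))
  · intro r' hr' r'' hr'' h0 ho
    rw [update_apply] at h0
    rw [update_apply, update_apply] at ho
    split_ifs at h0 ho with h1 h2 h2
    · rw [h1, h2]
    · exact absurd ho.symm (hol r'' hr'')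
    · exact absurd ho (hol r' hr')
    · exact h.injective r' hr' r'' hr'' h0 ho
  · intro l' hl' hv'
    by_cases h1 : l' = l
    · subst h1
      exact ⟨r, hr, by rw [update_self]⟩
    · rw [update_of_ne (by omega), update_apply] at hv'
      split_ifs at hv' with h2
      · exact absurd rfl hv'
      · obtain ⟨r', hr', ho⟩ := h.matched l' hl' hv'
        refine ⟨r', hr', ?_⟩
        rw [update_of_ne, ho]
        rintro rfl
        exact h2 ho.symm

theorem auction_zero (n : ℕ) (M : ℕ → ℕ) :
    Auction n M (fun _ => 0) (fun _ => 0) (fun _ => 0) := by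
  constructor <;> simp

theorem Auction.sum_le {n : ℕ} {M p o v : ℕ → ℕ} (h : Auction n M p o v) :
    ∑ r ∈ Finset.range n, p r ≤ n * (n + 1) := by
  have := Finset.sum_le_card_nsmul (Finset.range n) p (n + 1)
    fun r hr => h.price_le r (Finset.mem_range.mp hr)
  simpa using this

open Function in
theorem sum_update_add_one {n r : ℕ} (p : ℕ → ℕ) (hr : r < n) :
    ∑ r' ∈ Finset.range n, update p r (p r + 1) r' = ∑ r' ∈ Finset.range n, p r' + 1 := by
  rw [Finset.sum_update_of_mem (Finset.mem_range.mpr hr),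
    ← Finset.add_sum_erase _ _ (Finset.mem_range.mpr hr), Finset.sdiff_singleton_eq_erase]
  omega

/-- Some price between `0` and `n` is not taken by any of the `n` columns. -/
theorem exists_gap (n : ℕ) (p : ℕ → ℕ) : ∃ j ≤ n, ∀ r < n, p r ≠ j := by
  by_contra! h
  have hsub : Finset.range (n + 1) ⊆ (Finset.range n).image p := by
    intro j hj
    obtain ⟨r, hr, hrj⟩ := h j (by simpa [Nat.lt_succ_iff] using hj)
    exact Finset.mem_image.mpr ⟨r, Finset.mem_range.mpr hr, hrj⟩
  have h1 := (Finset.card_le_card hsub).trans Finset.card_image_le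
  simp at h1

/-- A settled row without a column sees only prices above `n`, hence above `j`. A row paying more
than `j` sees only prices at least `j` by slack, and `j` itself is not a price. -/
theorem Auction.hallPair {n : ℕ} {M p o v : ℕ → ℕ} (h : Auction n M p o v)
    (hs : ∀ l < n, Settled n M p v l) {j : ℕ} (hj : j ≤ n) (hgap : ∀ r < n, p r ≠ j)
    (G : SimpleGraph (Fin n)) (hG : ∀ x y : Fin n, M (x * n + y) ≠ 0 ↔ G.Adj x y) :
    HallPair G (fun r l : Fin n => o r = l + 1)
      {l | v (l + 1) = 0 ∨ j < v (l + 1)} {r | j < p r} where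
  adj {r l} ho := (hG l r).mp (h.adj r r.2 l ho)
  functional {r l l'} ho ho' := Fin.ext (by omega)
  injective {r r' l} ho ho' := Fin.ext (h.injective r r.2 r' r'.2 (by omega) (by omega))
  neighbor {l r} hl hadj := by
    have hM := (hG l r).mpr hadj
    have hg := hgap r r.2
    simp only [Set.mem_ofPred_eq] at hl ⊢
    by_cases hv : v (l + 1) = 0
    · rcases hs l l.2 with h1 | h1
      · exact absurd hv h1
      · have := h1 r r.2 hM
        omega
    · obtain ⟨r', hr', ho⟩ := h.matched l l.2 hv
      have h1 := h.slack r' hr' l ho r r.2 hM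
      rw [← h.value r' hr' l ho] at h1
      omega
  owned r hr := by
    simp only [Set.mem_ofPred_eq] at hr
    have h0 := (h.price_ne r r.2).mp (by omega)
    have hle := h.owner_le r r.2
    obtain ⟨l, hl⟩ := Nat.exists_eq_succ_of_ne_zero h0
    have hv := h.value r r.2 l hl
    exact ⟨⟨l, by omega⟩, Or.inr (by simpa [hv] using hr), hl⟩
  matched l hl := by
    simp only [Set.mem_ofPred_eq, not_or] at hl
    obtain ⟨r, hr, ho⟩ := h.matched l l.2 hl.1
    exact ⟨⟨r, hr⟩, ho⟩

/-! ## The parts of the program -/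

infixr:60 " ;; " => Prog.seq

open Prog

/-- Write the multiples of `reg b` to the array `a`, and the square of `reg b` to register `6`. -/
def multiples (b a : ℕ) : Prog :=
  const 5 0 ;; const 6 0 ;; forDown 4 b (store a 5 6 ;; add 6 6 b ;; add 5 5 3)

theorem reaches_multiples {b a N : ℕ} {s : State} (hb : s.reg b = N) (h2 : s.reg 2 = 0)
    (h3 : s.reg 3 = 1) (hb' : b ≠ 4 ∧ b ≠ 5 ∧ b ≠ 6) :
    (multiples b a).Reaches (5 * N + 4) s
      (fun s' => s'.reg 6 = N * N ∧ ∀ i < N, s'.arr a i = i * N) := by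
  obtain ⟨hb4, hb5, hb6⟩ := hb'
  have hinit : (const 5 0).Reaches 1 s fun s => s.reg 5 = 0 :=
    reaches_run rfl (by simp [Prog.run, State.setReg])
  have hinit' : ∀ s : State, s.reg 5 = 0 →
      (const 6 0).Reaches 1 s fun s => s.reg 5 = 0 ∧ s.reg 6 = 0 := fun s hs =>
    reaches_run rfl (by simp [Prog.run, State.setReg, hs])
  refine (hinit.seq fun s₁ hf₁ hs₁ => (hinit' s₁ hs₁).seq fun s₂ hf₂ hs₂ => ?_).mono
    (T := 1 + (1 + (N * (3 + 2) + 2))) (by omega) fun _ _ h => h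
  refine Reaches.mono (reaches_forDown (N := N) (T := 3)
    (fun i s => s.reg 5 + i = N ∧ s.reg 6 = s.reg 5 * N ∧ ∀ x < s.reg 5, s.arr a x = x * N)
    ?_ ?_ ?_ ?_ ?_ ?_ (by simp [Prog.regs]) (by decide) (by simp [Prog.regs])) le_rfl ?_
  · rw [hf₂.1 b (by simp [Prog.regs, hb6]), hf₁.1 b (by simp [Prog.regs, hb5]), hb]
  · rw [hf₂.1 2 (by decide), hf₁.1 2 (by decide), h2]
  · rw [hf₂.1 3 (by decide), hf₁.1 3 (by decide), h3]
  · intro i s v h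
    simpa [State.setReg] using h
  · simp [hs₂]
  · rintro i hi s' hf hc ⟨h5, h6, ha⟩
    have hb' : s'.reg b = N := by
      rw [hf.1 b (by simp [forDown, Prog.regs, hb4, hb5, hb6]),
        hf₂.1 b (by simp [Prog.regs, hb6]), hf₁.1 b (by simp [Prog.regs, hb5]), hb]
    have h3' : s'.reg 3 = 1 := by
      rw [hf.1 3 (by simp [forDown, Prog.regs]), hf₂.1 3 (by decide), hf₁.1 3 (by decide), h3]
    refine reaches_run rfl ?_
    simp only [Prog.run, State.setReg, State.setArr, Function.update_apply, h3', hb', h6,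
      reduceIte, Nat.reduceEqDiff]
    refine ⟨by omega, by ring, fun x hx => ?_⟩
    split_ifs with hx'
    · rw [hx']
    · exact ha x (by omega)
  · rintro s' - ⟨h5, h6, ha⟩
    rw [add_zero] at h5
    rw [h5] at h6 ha
    exact ⟨h6, ha⟩

/-- Copy the first `reg 6` cells of array `0` to array `6`. -/
def copyMatrix : Prog := forDown 4 6 (load 5 0 4 ;; store 6 4 5)

theorem reaches_copyMatrix {N : ℕ} {s : State} (h6 : s.reg 6 = N) (h2 : s.reg 2 = 0)
    (h3 : s.reg 3 = 1) :
    copyMatrix.Reaches (4 * N + 2) s (fun s' => ∀ x < N, s'.arr 6 x = s.arr 0 x) := by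
  refine Reaches.mono (reaches_forDown (N := N) (T := 2)
    (fun i s' => ∀ x < N, i ≤ x → s'.arr 6 x = s.arr 0 x)
    h6 h2 h3 (fun i s v h => h) (fun x hx hx' => by omega) ?_) (by omega)
    fun s' _ h x hx => h x hx (Nat.zero_le x)
  intro i hi s' hf hc ha
  refine reaches_run rfl ?_
  have h0 := hf.2 0 (by decide)
  intro x hx hix
  simp only [Prog.run, State.setReg, State.setArr, Function.update_apply, h0, hc,
    reduceIte, Nat.reduceEqDiff]
  split_ifs with hx'
  · rw [hx']
  · exact ha x hx (by omega)

/-- What the main parts of the program may take for granted. -/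
structure Env (n : ℕ) (M : ℕ → ℕ) (s : State) : Prop where
  reg0 : s.reg 0 = n
  reg2 : s.reg 2 = 0
  reg3 : s.reg 3 = 1
  reg7 : s.reg 7 = n + 1
  arr1 : ∀ i < n, s.arr 1 i = i * n
  arr6 : s.arr 6 = M

theorem Env.frame {n : ℕ} {M : ℕ → ℕ} {s s' : State} {p : Prog} (h : Env n M s)
    (hf : p.Frame s s') (hr : ∀ r ∈ [0, 2, 3, 7], r ∉ p.regs := by decide)
    (ha : ∀ a ∈ [1, 6], a ∉ p.arrs := by decide) : Env n M s' where
  reg0 := by rw [hf.1 0 (hr 0 (by decide)), h.reg0]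
  reg2 := by rw [hf.1 2 (hr 2 (by decide)), h.reg2]
  reg3 := by rw [hf.1 3 (hr 3 (by decide)), h.reg3]
  reg7 := by rw [hf.1 7 (hr 7 (by decide)), h.reg7]
  arr1 := by rw [hf.2 1 (ha 1 (by decide))]; exact h.arr1
  arr6 := by rw [hf.2 6 (ha 6 (by decide)), h.arr6]

/-! ### Running the auction -/

/-- Find the cheapest neighbor (register `12`, price in register `11`) of the row that starts at
`reg 13`. -/
def cheapest : Prog :=
  add 11 7 2 ;; forDown 10 0 (add 14 13 10 ;; load 14 6 14 ;; load 15 2 10 ;; sub 16 11 15 ;;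
    ite 14 (ite 16 (add 11 15 2 ;; add 12 10 2) skip) skip)

theorem reaches_cheapest {n : ℕ} {M : ℕ → ℕ} {s : State} (h : Env n M s) :
    cheapest.Reaches (14 * n + 3) s (fun s' => (s'.reg 11 ≤ n + 1 ∧
      ∀ r < n, M (s.reg 13 + r) ≠ 0 → s'.reg 11 ≤ s.arr 2 r) ∧
      (s'.reg 11 ≤ n → s'.reg 12 < n ∧ M (s.reg 13 + s'.reg 12) ≠ 0 ∧
        s.arr 2 (s'.reg 12) = s'.reg 11)) := by
  -- The starting price `n + 1` means that no affordable column has been found; register `12` is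
  -- meaningful only below it.
  have hinit : (add 11 7 2).Reaches 1 s fun s => s.reg 11 = n + 1 :=
    reaches_run rfl (by simp [Prog.run, State.setReg, h.reg7, h.reg2])
  refine (hinit.seq fun s₁ hf₁ hs₁ => ?_).mono (T := 1 + (n * (12 + 2) + 2)) (by omega)
    fun _ _ h => h
  have h₁ := h.frame hf₁
  refine Reaches.mono (reaches_forDown (N := n) (T := 12)
    (fun i s' => (s'.reg 11 ≤ n + 1 ∧
      ∀ r < n, i ≤ r → M (s.reg 13 + r) ≠ 0 → s'.reg 11 ≤ s.arr 2 r) ∧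
      (s'.reg 11 ≤ n → s'.reg 12 < n ∧ M (s.reg 13 + s'.reg 12) ≠ 0 ∧
        s.arr 2 (s'.reg 12) = s'.reg 11))
    h₁.reg0 h₁.reg2 h₁.reg3 ?_ ?_ ?_) le_rfl ?_
  · intro i s v h
    simpa [State.setReg] using h
  · exact ⟨⟨hs₁.le, fun r hr hr' => by omega⟩, fun h' => by omega⟩
  · rintro i hi s' hf hc ⟨⟨hle, hmin⟩, hatt⟩
    have h' := h₁.frame hf
    have h13 : s'.reg 13 = s.reg 13 := by rw [hf.1 13 (by decide), hf₁.1 13 (by decide)]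
    have hP : s'.arr 2 = s.arr 2 := by rw [hf.2 2 (by decide), hf₁.2 2 (by decide)]
    refine (reaches_run rfl ?_).mono (T := Prog.cost _) (by simp [Prog.cost]) fun _ _ h => h
    simp only [Prog.run, State.setReg, Function.update_apply, h13, hc, hP, h'.arr6,
      reduceIte, Nat.reduceEqDiff, h'.reg2, add_zero]
    have hmin' : M (s.reg 13 + i) = 0 ∨ s'.reg 11 ≤ s.arr 2 i →
        ∀ r < n, i ≤ r → M (s.reg 13 + r) ≠ 0 → s'.reg 11 ≤ s.arr 2 r := by
      intro hor r hr hir hM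
      rcases hir.eq_or_lt with rfl | hlt
      · tauto
      · exact hmin r hr hlt hM
    split_ifs with hM hlt
    · simpa using ⟨⟨hle, hmin' (Or.inl hM)⟩, hatt⟩
    · simpa using ⟨⟨hle, hmin' (Or.inr (by omega))⟩, hatt⟩
    · simp only [Function.update_apply, reduceIte, Nat.reduceEqDiff]
      refine ⟨⟨by omega, fun r hr hir hMr => ?_⟩, fun _ => ⟨hi, hM, trivial⟩⟩
      rcases hir.eq_or_lt with rfl | hlt'
      · exact le_rfl
      · have := hmin r hr hlt' hMr
        omega
  · rintro s' - ⟨⟨h1, h2⟩, h3⟩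
    exact ⟨⟨h1, fun r hr => h2 r hr (Nat.zero_le r)⟩, h3⟩

/-- Row `reg 9` buys column `reg 12` at the price `reg 11 + 1`. -/
def buy : Prog :=
  load 20 3 12 ;; store 4 20 2 ;; store 3 12 17 ;; add 11 11 3 ;; store 4 17 11 ;; store 2 12 11 ;;
    const 8 1

/-- Row `reg 9` bids. -/
def bidRow : Prog :=
  load 13 1 9 ;; cheapest ;; add 17 9 3 ;; load 18 4 17 ;; sub 19 7 11 ;;
    ite 18 skip (ite 19 buy skip)

/-- The auction whose data are in the arrays `2`, `3`, `4`. -/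
def State.Auctions (s : State) (n : ℕ) (M : ℕ → ℕ) : Prop :=
  Auction n M (s.arr 2) (s.arr 3) (s.arr 4)

theorem reaches_bidRow {n : ℕ} {M : ℕ → ℕ} {s : State} (h : Env n M s) (hl : s.reg 9 < n)
    (ha : s.Auctions n M) :
    bidRow.Reaches (14 * n + 20) s (fun s' => s'.Auctions n M ∧
      ((s'.reg 8 = s.reg 8 ∧ s'.arr 2 = s.arr 2 ∧ s'.arr 4 = s.arr 4 ∧
        Settled n M (s.arr 2) (s.arr 4) (s.reg 9)) ∨
      (s'.reg 8 = 1 ∧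
        ∑ r ∈ Finset.range n, s'.arr 2 r = ∑ r ∈ Finset.range n, s.arr 2 r + 1))) := by
  have hinit : (load 13 1 9).Reaches 1 s fun s' => s'.reg 13 = s.reg 9 * n :=
    reaches_run rfl (by simp [Prog.run, State.setReg, h.arr1 _ hl])
  refine (hinit.seq fun s₁ hf₁ hs₁ => (reaches_cheapest (h.frame hf₁)).seq
    (T' := 16) fun s₂ hf₂ hs₂ => ?_).mono (by omega) fun _ _ h => h
  have h₂ := (h.frame hf₁).frame hf₂
  rw [hs₁, hf₁.2 2 (by decide)] at hs₂
  have h8 : s₂.reg 8 = s.reg 8 := by rw [hf₂.1 8 (by decide), hf₁.1 8 (by decide)]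
  have h9 : s₂.reg 9 = s.reg 9 := by rw [hf₂.1 9 (by decide), hf₁.1 9 (by decide)]
  have hP : s₂.arr 2 = s.arr 2 := by rw [hf₂.2 2 (by decide), hf₁.2 2 (by decide)]
  have hO : s₂.arr 3 = s.arr 3 := by rw [hf₂.2 3 (by decide), hf₁.2 3 (by decide)]
  have hV : s₂.arr 4 = s.arr 4 := by rw [hf₂.2 4 (by decide), hf₁.2 4 (by decide)]
  obtain ⟨⟨hle, hmin⟩, hatt⟩ := hs₂
  refine (reaches_run rfl ?_).mono (T := Prog.cost _) (by simp [Prog.cost, buy]) fun _ _ h => h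
  simp only [Prog.run, State.setReg, State.Auctions, Function.update_apply,
    reduceIte, Nat.reduceEqDiff, h9, hV, h₂.reg7, h₂.reg3]
  split_ifs with hv hlt
  · simp only [Function.update_apply, reduceIte, Nat.reduceEqDiff, h8, hP, hO, hV]
    exact ⟨ha, Or.inl ⟨trivial, trivial, trivial, Or.inr fun r hr hM => by
      have := hmin r hr hM; omega⟩⟩
  · simp only [buy, Prog.run, State.setReg, State.setArr, Function.update_apply,
      reduceIte, Nat.reduceEqDiff, h8, hP, hO, hV, h₂.reg3, h₂.reg2]
    obtain ⟨h12, hM, hp⟩ := hatt (by omega)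
    rw [← hp] at hmin ⊢
    exact ⟨ha.bid hl hv h12 hM (by omega) hmin, Or.inr ⟨trivial, by
      simpa [Function.update_apply] using sum_update_add_one (s.arr 2) h12⟩⟩
  · simp only [Function.update_apply, reduceIte, Nat.reduceEqDiff, h8, hP, hO, hV]
    exact ⟨ha, Or.inl ⟨trivial, trivial, trivial, Or.inl hv⟩⟩

/-- All rows bid until none of them has a reason to. -/
def auction : Prog := const 8 1 ;; loop 8 (const 8 0 ;; forDown 9 0 bidRow)

theorem reaches_auction {n : ℕ} {M : ℕ → ℕ} {s : State} (h : Env n M s) (ha : s.Auctions n M) :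
    auction.Reaches ((n * (n + 1) + 1) * (n * (14 * n + 22) + 4) + 2) s
      (fun s' => s'.Auctions n M ∧ ∀ l < n, Settled n M (s'.arr 2) (s'.arr 4) l) := by
  have hinit : (const 8 1).Reaches 1 s fun s' => s'.reg 8 = 1 :=
    reaches_run rfl (by simp [Prog.run, State.setReg])
  refine (hinit.seq fun s₁ hf₁ hs₁ => ?_).mono
    (T := 1 + ((n * (n + 1) + 1) * (n * (14 * n + 22) + 4) + 1)) (by omega) fun _ _ h => h
  have h₁ := h.frame hf₁
  -- The measure is the room left for the sum of the prices, plus the flag. A pass with a bid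
  -- shrinks the room; a pass without one clears the flag, and since prices and values did not
  -- change during it, every row was tested against the final ones.
  refine (reaches_loop (T := n * (14 * n + 22) + 3) (fun s => s.Auctions n M ∧ s.reg 8 ≤ 1 ∧
      (s.reg 8 = 0 → ∀ l < n, Settled n M (s.arr 2) (s.arr 4) l))
    (fun s => n * (n + 1) - ∑ r ∈ Finset.range n, s.arr 2 r + s.reg 8) ?_ ?_).mono ?_ ?_
  · rintro s₂ hf₂ ⟨ha₂, hle, -⟩ hne
    have h₂ := h₁.frame hf₂
    have hstart : (const 8 0).Reaches 1 s₂ fun s' => s'.reg 8 = 0 :=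
      reaches_run rfl (by simp [Prog.run, State.setReg])
    refine (hstart.seq fun s₃ hf₃ hs₃ => ?_).mono
      (T := 1 + (n * (14 * n + 20 + 2) + 2)) (Nat.le_of_eq (by ring)) fun _ _ h => h
    have h₃ := h₂.frame hf₃
    refine Reaches.mono (reaches_forDown (N := n) (T := 14 * n + 20)
      (fun i s' => s'.Auctions n M ∧
        ((s'.reg 8 = 0 ∧ s'.arr 2 = s₂.arr 2 ∧ s'.arr 4 = s₂.arr 4 ∧
          ∀ l < n, i ≤ l → Settled n M (s₂.arr 2) (s₂.arr 4) l) ∨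
        (s'.reg 8 = 1 ∧ ∑ r ∈ Finset.range n, s₂.arr 2 r < ∑ r ∈ Finset.range n, s'.arr 2 r)))
      h₃.reg0 h₃.reg2 h₃.reg3 ?_ ?_ ?_) le_rfl ?_
    · intro i s v h
      simpa [State.setReg, State.Auctions] using h
    · refine ⟨?_, Or.inl ⟨hs₃, hf₃.2 2 (by decide), hf₃.2 4 (by decide), fun l hl hl' => by omega⟩⟩
      rwa [State.Auctions, hf₃.2 2 (by decide), hf₃.2 3 (by decide), hf₃.2 4 (by decide)]
    · rintro i hi s₄ hf₄ hc ⟨ha₄, hs₄⟩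
      refine (reaches_bidRow (h₃.frame hf₄) (by omega) ha₄).mono le_rfl fun s₅ _ hs₅ => ⟨hs₅.1, ?_⟩
      rcases hs₄ with ⟨e8, e2, e4, hset⟩ | ⟨e8, hlt⟩ <;>
        rcases hs₅.2 with ⟨f8, f2, f4, hset'⟩ | ⟨f8, hlt'⟩
      · refine Or.inl ⟨by omega, by rw [f2, e2], by rw [f4, e4], fun l hl hil => ?_⟩
        rcases hil.eq_or_lt with rfl | hlt
        · rwa [e2, e4, hc] at hset'
        · exact hset l hl hlt
      · exact Or.inr ⟨f8, by rw [hlt', e2]; omega⟩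
      · exact Or.inr ⟨by omega, by rwa [f2]⟩
      · exact Or.inr ⟨f8, by omega⟩
    · rintro s₆ - ⟨ha₆, ⟨e8, e2, e4, hset⟩ | ⟨e8, hlt⟩⟩
      · refine ⟨⟨ha₆, by omega, fun _ l hl => ?_⟩, ?_⟩
        · rw [e2, e4]
          exact hset l hl (Nat.zero_le l)
        · rw [e2]
          omega
      -- The bound on the new sum ensures that the truncated difference in the measure really drops.
      · have := ha₆.sum_le
        exact ⟨⟨ha₆, by omega, fun h' => by omega⟩, by omega⟩
  · refine ⟨?_, hs₁.le, fun h' => by omega⟩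
    rwa [State.Auctions, hf₁.2 2 (by decide), hf₁.2 3 (by decide), hf₁.2 4 (by decide)]
  · rw [hs₁]
    gcongr
    omega
  · exact fun s' _ h => ⟨h.1.1, h.1.2.2 h.2⟩

/-! ### Reading the decomposition off the prices -/

/-- Set register `11` to a nonzero number if and only if no price equals `reg 9`. -/
def levelFree : Prog :=
  const 11 1 ;; forDown 10 0 (load 12 2 10 ;; sub 13 12 9 ;; sub 14 9 12 ;; add 13 13 14 ;;
    ite 13 skip (const 11 0))

theorem reaches_levelFree {n : ℕ} {M : ℕ → ℕ} {s : State} (h : Env n M s) :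
    levelFree.Reaches (9 * n + 3) s
      (fun s' => s'.reg 11 ≠ 0 ↔ ∀ r < n, s.arr 2 r ≠ s.reg 9) := by
  have hinit : (const 11 1).Reaches 1 s fun s => s.reg 11 = 1 :=
    reaches_run rfl (by simp [Prog.run, State.setReg])
  refine (hinit.seq fun s₁ hf₁ hs₁ => ?_).mono (T := 1 + (n * (7 + 2) + 2)) (by omega)
    fun _ _ h => h
  have h₁ := h.frame hf₁
  refine Reaches.mono (reaches_forDown (N := n) (T := 7)
    (fun i s' => s'.reg 11 ≠ 0 ↔ ∀ r < n, i ≤ r → s.arr 2 r ≠ s.reg 9)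
    h₁.reg0 h₁.reg2 h₁.reg3 ?_ ?_ ?_) le_rfl fun s' _ h => by simpa using h
  · intro i s v h
    simpa [State.setReg] using h
  · simp only [hs₁, ne_eq, one_ne_zero, not_false_eq_true, true_iff]
    intro r hr hr'
    omega
  · intro i hi s' hf hc hs'
    have h9 : s'.reg 9 = s.reg 9 := by rw [hf.1 9 (by decide), hf₁.1 9 (by decide)]
    have hP : s'.arr 2 = s.arr 2 := by rw [hf.2 2 (by decide), hf₁.2 2 (by decide)]
    refine (reaches_run rfl ?_).mono (T := Prog.cost _) (by simp [Prog.cost]) fun _ _ h => h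
    simp only [Prog.run, State.setReg, Function.update_apply, hc, h9, hP, reduceIte,
      Nat.reduceEqDiff]
    -- Register `13` holds the sum of both truncated differences, which vanishes exactly when the
    -- price equals the level.
    split_ifs with h0
    · simp only [Function.update_apply, reduceIte, ne_eq, not_true_eq_false, false_iff, not_forall]
      exact ⟨i, hi, le_rfl, fun h => h (by omega)⟩
    · simp only [Function.update_apply, reduceIte, Nat.reduceEqDiff]
      rw [hs']
      refine ⟨fun h r hr hir => ?_, fun h r hr hir => h r hr (by omega)⟩
      rcases hir.eq_or_lt with rfl | hlt
      · omega
      · exact h r hr hlt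

/-- Find a number from `0` to `n` that is not a price, and store it in register `21`. -/
def findGap : Prog := forDown 9 7 (levelFree ;; ite 11 (add 21 9 2) skip)

theorem reaches_findGap {n : ℕ} {M : ℕ → ℕ} {s : State} (h : Env n M s) :
    findGap.Reaches ((n + 1) * (9 * n + 8) + 2) s
      (fun s' => s'.reg 21 ≤ n ∧ ∀ r < n, s.arr 2 r ≠ s'.reg 21) := by
  -- The invariant is conditional: register `21` need only be right once a gap at level `i` or
  -- higher exists. At `i = 0` the condition holds by `exists_gap`.
  refine Reaches.mono (reaches_forDown (N := n + 1) (T := 9 * n + 6)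
    (fun i s' => (∃ j ≤ n, i ≤ j ∧ ∀ r < n, s.arr 2 r ≠ j) →
      s'.reg 21 ≤ n ∧ ∀ r < n, s.arr 2 r ≠ s'.reg 21)
    h.reg7 h.reg2 h.reg3 ?_ ?_ ?_) le_rfl fun s' _ h => ?_
  · intro i s v h
    simpa [State.setReg] using h
  · rintro ⟨j, hj, hj', -⟩
    omega
  · intro i hi s' hf hc hs'
    have h' := h.frame hf
    have hP : s'.arr 2 = s.arr 2 := hf.2 2 (by decide)
    refine ((reaches_levelFree h').seq (T' := 3) fun s₁ hf₁ hs₁ => ?_).mono (by omega)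
      fun _ _ h => h
    have h21 : s₁.reg 21 = s'.reg 21 := hf₁.1 21 (by decide)
    have h9 : s₁.reg 9 = i := by rw [hf₁.1 9 (by decide), hc]
    rw [hP, hc] at hs₁
    refine (reaches_run rfl ?_).mono (T := Prog.cost _) (by simp [Prog.cost]) fun _ _ h => h
    simp only [Prog.run, State.setReg]
    split_ifs with h0
    · rintro ⟨j, hj, hij, hg⟩
      rw [h21]
      refine hs' ⟨j, hj, lt_of_le_of_ne hij ?_, hg⟩
      rintro rfl
      exact hs₁.mpr hg h0
    · intro _
      simp only [Function.update_self, h9, (h'.frame hf₁).reg2, add_zero]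
      exact ⟨by omega, hs₁.mp h0⟩
  · obtain ⟨j, hj, hg⟩ := exists_gap n (s.arr 2)
    exact h ⟨j, hj, Nat.zero_le j, hg⟩

/-- The first `m` cells of `L` list the numbers from `i` to `n - 1` that are in both or in none of
`A` and `B`, and `k` of these numbers are in `B` but not in `A`. -/
structure Selected (A B : ℕ → Prop) (n i m k : ℕ) (L : ℕ → ℕ) : Prop where
  mem : ∀ a < m, i ≤ L a ∧ L a < n ∧ (A (L a) ↔ B (L a))
  injective : ∀ a < m, ∀ b < m, L a = L b → a = b
  surjective : ∀ x < n, i ≤ x → (A x ↔ B x) → ∃ a < m, L a = x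
  count : k = {x | i ≤ x ∧ x < n ∧ B x ∧ ¬A x}.ncard

namespace Selected

variable {A B : ℕ → Prop} {n i m k : ℕ} {L : ℕ → ℕ}

theorem start (L : ℕ → ℕ) : Selected A B n n 0 0 L where
  mem a ha := by omega
  injective a ha := by omega
  surjective x hx hx' := by omega
  count := by
    rw [eq_comm, Set.ncard_eq_zero ((Set.finite_lt_nat n).subset fun x hx => hx.2.1)]
    refine Set.eq_empty_of_forall_notMem fun x hx => ?_
    have := hx.1
    have := hx.2.1
    omega

theorem count_of_not (h : Selected A B n (i + 1) m k L) (hi : ¬(B i ∧ ¬A i)) :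
    k = {x | i ≤ x ∧ x < n ∧ B x ∧ ¬A x}.ncard := by
  rw [h.count]
  congr 1
  ext x
  simp only [Set.mem_ofPred_eq]
  refine ⟨fun h => ⟨by omega, h.2⟩, fun h => ⟨lt_of_le_of_ne h.1 ?_, h.2⟩⟩
  rintro rfl
  exact hi h.2.2

theorem skip (h : Selected A B n (i + 1) m k L) (hA : A i) (hB : ¬B i) :
    Selected A B n i m k L where
  mem a ha := ⟨by have := (h.mem a ha).1; omega, (h.mem a ha).2⟩
  injective := h.injective
  surjective x hx hix hAB := h.surjective x hx (lt_of_le_of_ne hix (by rintro rfl; tauto)) hAB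
  count := h.count_of_not (by tauto)

theorem incr (h : Selected A B n (i + 1) m k L) (hi : i < n) (hA : ¬A i) (hB : B i) :
    Selected A B n i m (k + 1) L where
  mem a ha := ⟨by have := (h.mem a ha).1; omega, (h.mem a ha).2⟩
  injective := h.injective
  surjective x hx hix hAB := h.surjective x hx (lt_of_le_of_ne hix (by rintro rfl; tauto)) hAB
  count := by
    have hins : {x | i ≤ x ∧ x < n ∧ B x ∧ ¬A x} =
        insert i {x | i + 1 ≤ x ∧ x < n ∧ B x ∧ ¬A x} := by
      ext x
      simp only [Set.mem_ofPred_eq, Set.mem_insert_iff]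
      constructor
      · rintro ⟨h1, h2⟩
        rcases h1.eq_or_lt with rfl | h1
        · exact Or.inl rfl
        · exact Or.inr ⟨h1, h2⟩
      · rintro (rfl | ⟨h1, h2⟩)
        · exact ⟨le_rfl, hi, hB, hA⟩
        · exact ⟨by omega, h2⟩
    rw [hins, Set.ncard_insert_of_notMem (by simp)
      ((Set.finite_lt_nat n).subset fun x hx => hx.2.1), h.count]

theorem push (h : Selected A B n (i + 1) m k L) (hi : i < n) (hAB : A i ↔ B i) :
    Selected A B n i (m + 1) k (Function.update L m i) where
  mem a ha := by
    rw [Function.update_apply]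
    split_ifs with hm
    · exact ⟨le_rfl, hi, hAB⟩
    · have := h.mem a (by omega)
      exact ⟨by omega, this.2⟩
  injective a ha b hb hab := by
    rw [Function.update_apply, Function.update_apply] at hab
    split_ifs at hab with h1 h2 h2
    · omega
    · have := (h.mem b (by omega)).1
      omega
    · have := (h.mem a (by omega)).1
      omega
    · exact h.injective a (by omega) b (by omega) hab
  surjective x hx hix hAB := by
    rcases hix.eq_or_lt with rfl | hlt
    · exact ⟨m, by omega, by simp⟩
    · obtain ⟨a, ha, hax⟩ := h.surjective x hx hlt hAB
      exact ⟨a, by omega, by rw [Function.update_of_ne (by omega), hax]⟩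
  count := h.count_of_not (by tauto)

end Selected

/-- Append `reg 9` to the list in array `5`, the length of which is in register `22`. -/
def pushRow : Prog := store 5 22 9 ;; add 22 22 3

/-- Compare prices with the gap in register `21`. List the vertices on the same side in both copies
in array `5`, and count those that are above the gap as columns only in register `23`. -/
def select : Prog :=
  const 22 0 ;; const 23 0 ;; forDown 9 0 (load 11 2 9 ;; sub 11 11 21 ;; add 12 9 3 ;;
    load 12 4 12 ;; ite 12 (sub 12 12 21) (const 12 1) ;;
    ite 11 (ite 12 pushRow (add 23 23 3)) (ite 12 skip pushRow))

theorem reaches_select {n : ℕ} {M : ℕ → ℕ} {s : State} (h : Env n M s) :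
    select.Reaches (20 * n + 4) s (fun s' =>
      Selected (fun l => s.arr 4 (l + 1) = 0 ∨ s.reg 21 < s.arr 4 (l + 1))
        (fun r => s.reg 21 < s.arr 2 r) n 0 (s'.reg 22) (s'.reg 23) (s'.arr 5)) := by
  have hinit : (const 22 0).Reaches 1 s fun s => s.reg 22 = 0 :=
    reaches_run rfl (by simp [Prog.run, State.setReg])
  have hinit' : ∀ s : State, s.reg 22 = 0 →
      (const 23 0).Reaches 1 s fun s => s.reg 22 = 0 ∧ s.reg 23 = 0 := fun s hs =>
    reaches_run rfl (by simp [Prog.run, State.setReg, hs])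
  refine (hinit.seq fun s₁ hf₁ hs₁ => (hinit' s₁ hs₁).seq fun s₂ hf₂ hs₂ => ?_).mono
    (T := 1 + (1 + (n * (18 + 2) + 2))) (by omega) fun _ _ h => h
  have h₂ := (h.frame hf₁).frame hf₂
  refine reaches_forDown (N := n) (T := 18) (fun i s' =>
      Selected (fun l => s.arr 4 (l + 1) = 0 ∨ s.reg 21 < s.arr 4 (l + 1))
        (fun r => s.reg 21 < s.arr 2 r) n i (s'.reg 22) (s'.reg 23) (s'.arr 5))
    h₂.reg0 h₂.reg2 h₂.reg3 ?_ ?_ ?_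
  · intro i s v h
    simpa [State.setReg] using h
  · rw [hs₂.1, hs₂.2]
    exact .start _
  · intro i hi s' hf hc hs'
    have h' := h₂.frame hf
    have hP : s'.arr 2 = s.arr 2 := by
      rw [hf.2 2 (by decide), hf₂.2 2 (by decide), hf₁.2 2 (by decide)]
    have hV : s'.arr 4 = s.arr 4 := by
      rw [hf.2 4 (by decide), hf₂.2 4 (by decide), hf₁.2 4 (by decide)]
    have h21 : s'.reg 21 = s.reg 21 := by
      rw [hf.1 21 (by decide), hf₂.1 21 (by decide), hf₁.1 21 (by decide)]
    refine (reaches_run rfl ?_).mono (T := Prog.cost _) (by simp [Prog.cost, pushRow])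
      fun _ _ h => h
    simp only [Prog.run, pushRow, State.setReg, State.setArr, Function.update_apply, hc, hP, hV,
      h21, h'.reg3, reduceIte, Nat.reduceEqDiff]
    -- Every combination falls under one of three cases: in `A` only (dropped), in `B` only
    -- (counted), on the same side in both copies (kept).
    by_cases hv : s.arr 4 (i + 1) = 0 <;> by_cases hvj : s.arr 4 (i + 1) - s.reg 21 = 0 <;>
      by_cases hp : s.arr 2 i - s.reg 21 = 0 <;>
      simp only [hv, hvj, hp, Function.update_apply, reduceIte, Nat.reduceEqDiff, hc, h'.reg3]
    all_goals first
      | exact hs'.skip (by omega) (by omega)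
      | exact hs'.incr hi (by omega) (by omega)
      | exact hs'.push hi (by omega)

/-- Distinct matrix entries occupy distinct cells in the row-by-row layout. -/
theorem mul_add_inj {m a b a' b' : ℕ} (hb : b < m) (hb' : b' < m)
    (h : a * m + b = a' * m + b') : a = a' ∧ b = b' := by
  rcases lt_trichotomy a a' with hlt | rfl | hlt
  · have := Nat.mul_le_mul_right m hlt
    rw [Nat.succ_mul] at this
    omega
  · exact ⟨rfl, by omega⟩
  · have := Nat.mul_le_mul_right m hlt
    rw [Nat.succ_mul] at this
    omega

/-! ### Writing the reduced instance -/

/-- Write the adjacency matrix of the graph induced on the list in array `5` to array `0`. -/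
def submatrix : Prog :=
  multiples 22 7 ;; forDown 9 22 ((load 11 5 9 ;; load 11 1 11 ;; load 12 7 9) ;;
    forDown 10 22 (load 13 5 10 ;; add 13 13 11 ;; load 13 6 13 ;; add 14 12 10 ;; store 0 14 13))

/-- The entries are read from the copy in array `6`, so overwriting array `0` does no harm. Tables
of multiples of `n` and `m` replace multiplication. -/
theorem reaches_submatrix {n m : ℕ} {M : ℕ → ℕ} {s : State} (h : Env n M s) (hm : s.reg 22 = m)
    (hL : ∀ a < m, s.arr 5 a < n) :
    submatrix.Reaches (m * (7 * m + 7) + 5 * m + 6) s (fun s' =>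
      ∀ a < m, ∀ b < m, s'.arr 0 (a * m + b) = M (s.arr 5 a * n + s.arr 5 b)) := by
  refine ((reaches_multiples (a := 7) hm h.reg2 h.reg3 (by decide)).seq
    (T' := m * (7 * m + 5 + 2) + 2) fun s₁ hf₁ hs₁ => ?_).mono (by ring_nf; omega) fun _ _ h => h
  have h₁ := h.frame hf₁
  have hm₁ : s₁.reg 22 = m := by rw [hf₁.1 22 (by decide), hm]
  refine Reaches.mono (reaches_forDown (N := m) (T := 7 * m + 5) (fun i s' =>
      ∀ a < m, i ≤ a → ∀ b < m, s'.arr 0 (a * m + b) = M (s.arr 5 a * n + s.arr 5 b))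
    hm₁ h₁.reg2 h₁.reg3 (fun i s v h => h) (fun a ha ha' => by omega) ?_) le_rfl
    fun s' _ h a ha => h a ha (Nat.zero_le a)
  intro i hi s₂ hf₂ hc₂ hs₂
  have h₂ := h₁.frame hf₂
  have hL₂ : s₂.arr 5 = s.arr 5 := by rw [hf₂.2 5 (by decide), hf₁.2 5 (by decide)]
  have h7₂ : s₂.arr 7 i = i * m := by rw [hf₂.2 7 (by decide), hs₁.2 i hi]
  have hload : (load 11 5 9 ;; load 11 1 11 ;; load 12 7 9).Reaches 3 s₂ (fun s' =>
      s'.reg 11 = s.arr 5 i * n ∧ s'.reg 12 = i * m) := by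
    refine reaches_run rfl ?_
    simp only [Prog.run, State.setReg, Function.update_apply, reduceIte, Nat.reduceEqDiff, hc₂,
      hL₂, h7₂, h₂.arr1 _ (hL i hi), and_self]
  refine (hload.seq fun s₃ hf₃ hs₃ => ?_).mono (T := 3 + (m * (5 + 2) + 2)) (by omega)
    fun _ _ h => h
  have h₃ := h₂.frame hf₃
  have hm₃ : s₃.reg 22 = m := by rw [hf₃.1 22 (by decide), hf₂.1 22 (by decide), hm₁]
  have hc₃ : s₃.reg 9 = i := by rw [hf₃.1 9 (by decide), hc₂]
  -- Rows after `i` are complete, and row `i` is complete from column `j` on.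
  refine Reaches.mono (reaches_forDown (N := m) (T := 5) (fun j s' =>
      ∀ a < m, i ≤ a → ∀ b < m, (a = i → j ≤ b) →
        s'.arr 0 (a * m + b) = M (s.arr 5 a * n + s.arr 5 b))
    hm₃ h₃.reg2 h₃.reg3 (fun i s v h => h) (fun a ha hia b hb hab => ?_) ?_) le_rfl
    fun s' _ h a ha hia b hb => h a ha hia b hb fun _ => Nat.zero_le b
  · rw [hf₃.2 0 (by decide)]
    exact hs₂ a ha (by omega) b hb
  · intro j hj s₄ hf₄ hc₄ hs₄
    have h₄ := h₃.frame hf₄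
    have hL₄ : s₄.arr 5 = s.arr 5 := by rw [hf₄.2 5 (by decide), hf₃.2 5 (by decide), hL₂]
    have h11 : s₄.reg 11 = s.arr 5 i * n := by rw [hf₄.1 11 (by decide), hs₃.1]
    have h12 : s₄.reg 12 = i * m := by rw [hf₄.1 12 (by decide), hs₃.2]
    refine reaches_run rfl fun a ha hia b hb hab => ?_
    simp only [Prog.run, State.setReg, State.setArr, Function.update_apply, reduceIte,
      Nat.reduceEqDiff, hc₄, hL₄, h11, h12, h₄.arr6]
    split_ifs with hx
    · obtain ⟨rfl, rfl⟩ := mul_add_inj hb hj hx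
      rw [add_comm]
    · refine hs₄ a ha hia b hb fun hai => ?_
      have := hab hai
      rcases this.eq_or_lt with rfl | hlt
      · exact absurd (by rw [hai]) hx
      · exact hlt

/-- Output the graph with `reg 22` vertices in array `0` and the parameter `reg 1 - reg 23`, or
a trivial instance. -/
def finish : Prog :=
  sub 11 1 23 ;; add 12 11 11 ;; add 12 12 11 ;; add 13 22 3 ;; add 13 13 3 ;; add 13 13 3 ;;
    sub 13 13 12 ;; ite 11 (ite 13 (const 0 0 ;; const 1 0) (add 0 22 2 ;; add 1 11 2))
      (const 0 0 ;; const 1 0)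

theorem reaches_finish {s : State} (h2 : s.reg 2 = 0) (h3 : s.reg 3 = 1) :
    finish.Reaches 15 s (fun s' => s'.arr 0 = s.arr 0 ∧
      ((s'.reg 0 = 0 ∧ s'.reg 1 = 0 ∧
        (s.reg 1 ≤ s.reg 23 ∨ 3 * (s.reg 1 - s.reg 23) < s.reg 22 + 3)) ∨
      (s'.reg 0 = s.reg 22 ∧ s'.reg 1 = s.reg 1 - s.reg 23 ∧ s.reg 23 < s.reg 1 ∧
        s.reg 22 + 3 ≤ 3 * (s.reg 1 - s.reg 23)))) := by
  refine (reaches_run rfl ?_).mono (T := Prog.cost _) (by simp [Prog.cost, finish]) fun _ _ h => h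
  simp only [finish, Prog.run, State.setReg, Function.update_apply, h2, h3, reduceIte,
    Nat.reduceEqDiff]
  split_ifs with h1 h4
  all_goals
    simp only [Function.update_apply, reduceIte, Nat.reduceEqDiff, true_and]
    omega

/-- The list in memory serves as the embedding of the kept vertices, and the counter as the size of
`H`, so that `HallPair.storageCapacity_eq` applies to the machine's data. -/
theorem Selected.storageCapacity_eq {q n m k : ℕ} (hq : 2 ≤ q) {G : SimpleGraph (Fin n)}
    {own : Fin n → Fin n → Prop} {A B : ℕ → Prop} {L : ℕ → ℕ}
    (h : HallPair G own {l | A l} {r | B r}) (hs : Selected A B n 0 m k L) :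
    ∃ e : Fin m ↪ Fin n, (∀ a, (e a : ℕ) = L a) ∧
      storageCapacity q G = k + storageCapacity q (G.comap e) ∧
      ∃ c : ℕ, m ≤ 3 * c ∧ (c : ℝ) ≤ storageCapacity q (G.comap e) := by
  classical
  let e : Fin m ↪ Fin n := ⟨fun a => ⟨L a, (hs.mem a a.2).2.1⟩, fun a b hab =>
    Fin.ext (hs.injective a a.2 b b.2 (congrArg Fin.val hab))⟩
  let H : Finset (Fin n) := {v | B v ∧ ¬A v}
  have hH : H.card = k := by
    rw [hs.count, ← Finset.card_map Fin.valEmbedding, ← Set.ncard_coe_finset]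
    congr 1
    ext x
    simp only [H, Finset.coe_map, Fin.valEmbedding_apply, Finset.coe_filter, Finset.mem_univ,
      true_and, Set.mem_image, Set.mem_ofPred_eq, Nat.zero_le]
    constructor
    · rintro ⟨v, hv, rfl⟩
      exact ⟨v.2, hv⟩
    · rintro ⟨hx, hv⟩
      exact ⟨⟨x, hx⟩, hv, rfl⟩
  have := h.storageCapacity_eq hq e (fun v => ⟨?_, fun hv => ?_⟩) H (by simp [H])
  · rw [hH, Fintype.card_fin] at this
    exact ⟨e, fun _ => rfl, this⟩
  · rintro ⟨a, rfl⟩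
    exact (hs.mem a a.2).2.2
  · obtain ⟨a, ha, hav⟩ := hs.surjective v v.2 (Nat.zero_le _) hv
    exact ⟨⟨a, ha⟩, Fin.ext hav⟩

/-! ### The complete algorithm -/

/-- The kernelization algorithm. -/
def kernel : Prog :=
  const 3 1 ;; add 7 0 3 ;; multiples 0 1 ;; copyMatrix ;; auction ;; findGap ;; select ;;
    submatrix ;; finish

/-- A bound on the number of steps of `kernel` on graphs with `n` vertices. -/
def kernelSteps (n : ℕ) : ℕ :=
  1 + (1 + (5 * n + 4 + (4 * (n * n) + 2 + ((n * (n + 1) + 1) * (n * (14 * n + 22) + 4) + 2 +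
    ((n + 1) * (9 * n + 8) + 2 + (20 * n + 4 + (n * (7 * n + 7) + 5 * n + 6 + 15)))))))

theorem initState_arr_zero (I : GraphInstance) [DecidableRel I.graph.Adj] (x y : Fin I.n) :
    I.initState.arr 0 (x * I.n + y) = if I.graph.Adj x y then 1 else 0 := by
  classical
  simp only [GraphInstance.initState, true_and]
  congr 1
  refine propext ⟨?_, fun h => ⟨x, y, h, rfl⟩⟩
  rintro ⟨i, j, h, hij⟩
  obtain ⟨h1, h2⟩ := mul_add_inj y.2 j.2 hij
  rwa [Fin.ext h1, Fin.ext h2]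

theorem reaches_kernel {q : ℕ} (hq : 2 ≤ q) (I : GraphInstance) :
    kernel.Reaches (kernelSteps I.n) I.initState (fun s => ∃ J : GraphInstance, s.Represents J ∧
      (I ∈ StorageCapacityProblem q ↔ J ∈ StorageCapacityProblem q) ∧ J.n ≤ I.n ∧ J.k ≤ I.k ∧
      J.n ≤ 3 * J.k - 3) := by
  classical
  have harr : ∀ a, a ≠ 0 → I.initState.arr a = fun _ => 0 := fun a ha => by
    funext m
    simp [GraphInstance.initState, ha]
  have hreg : ∀ r, r ≠ 0 → r ≠ 1 → I.initState.reg r = 0 := fun r h0 h1 => by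
    simp [GraphInstance.initState, h0, h1]
  have hr0 : I.initState.reg 0 = I.n := by simp [GraphInstance.initState]
  have hr1 : I.initState.reg 1 = I.k := by simp [GraphInstance.initState]
  have hone : (const 3 1).Reaches 1 I.initState fun s => s.reg 3 = 1 :=
    reaches_run rfl (by simp [Prog.run, State.setReg])
  -- `kernelSteps` is bracketed like the program, so each use of `seq` peels off one summand.
  refine hone.seq fun s₁ f₁ h₁ => ?_
  have h₁0 : s₁.reg 0 = I.n := by rw [f₁.1 0 (by decide), hr0]
  have hsucc : (add 7 0 3).Reaches 1 s₁ fun s => s.reg 7 = I.n + 1 :=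
    reaches_run rfl (by simp [Prog.run, State.setReg, h₁0, h₁])
  refine hsucc.seq fun s₂ f₂ h₂ => ?_
  have h₂0 : s₂.reg 0 = I.n := by rw [f₂.1 0 (by decide), h₁0]
  have h₂2 : s₂.reg 2 = 0 := by
    rw [f₂.1 2 (by decide), f₁.1 2 (by decide), hreg 2 (by decide) (by decide)]
  have h₂3 : s₂.reg 3 = 1 := by rw [f₂.1 3 (by decide), h₁]
  refine (reaches_multiples h₂0 h₂2 h₂3 (by decide)).seq fun s₃ f₃ h₃ => ?_
  have h₃2 : s₃.reg 2 = 0 := by rw [f₃.1 2 (by decide), h₂2]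
  have h₃3 : s₃.reg 3 = 1 := by rw [f₃.1 3 (by decide), h₂3]
  refine (reaches_copyMatrix h₃.1 h₃2 h₃3).seq fun s₄ f₄ h₄ => ?_
  have henv : Env I.n (s₄.arr 6) s₄ :=
    { reg0 := by rw [f₄.1 0 (by decide), f₃.1 0 (by decide), h₂0]
      reg2 := by rw [f₄.1 2 (by decide), h₃2]
      reg3 := by rw [f₄.1 3 (by decide), h₃3]
      reg7 := by rw [f₄.1 7 (by decide), f₃.1 7 (by decide), h₂]
      arr1 := by rw [f₄.2 1 (by decide)]; exact h₃.2
      arr6 := rfl }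
  have hM : ∀ x y : Fin I.n, s₄.arr 6 (x * I.n + y) = if I.graph.Adj x y then 1 else 0 := by
    intro x y
    have hlt : (x : ℕ) * I.n + y < I.n * I.n := by
      have := Nat.mul_le_mul_right I.n x.2
      rw [Nat.succ_mul] at this
      omega
    rw [h₄ _ hlt, f₃.2 0 (by decide), f₂.2 0 (by decide), f₁.2 0 (by decide),
      initState_arr_zero]
  generalize s₄.arr 6 = M at henv hM
  have hauc : s₄.Auctions I.n M := by
    have hz : ∀ a, a ∉ [0, 1, 6] → s₄.arr a = fun _ => 0 := by
      intro a ha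
      simp only [List.mem_cons, List.not_mem_nil, or_false, not_or] at ha
      rw [f₄.2 a (by simp [copyMatrix, forDown, Prog.arrs, ha]),
        f₃.2 a (by simp [multiples, forDown, Prog.arrs, ha]), f₂.2 a (by simp [Prog.arrs]),
        f₁.2 a (by simp [Prog.arrs]), harr a ha.1]
    rw [State.Auctions, hz 2 (by decide), hz 3 (by decide), hz 4 (by decide)]
    exact auction_zero _ _
  refine (reaches_auction henv hauc).seq fun s₅ f₅ h₅ => ?_
  have e₅ := henv.frame f₅
  refine (reaches_findGap e₅).seq fun s₆ f₆ h₆ => ?_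
  have e₆ := e₅.frame f₆
  have hpair := h₅.1.hallPair h₅.2 h₆.1 h₆.2 I.graph (by simp [hM])
  refine (reaches_select e₆).seq fun s₇ f₇ h₇ => ?_
  have e₇ := e₆.frame f₇
  rw [f₆.2 2 (by decide), f₆.2 4 (by decide)] at h₇
  obtain ⟨e, he, hcap, c, hc, hc'⟩ := h₇.storageCapacity_eq hq hpair
  have hmn : s₇.reg 22 ≤ I.n := by simpa using Fintype.card_le_of_embedding e
  refine ((reaches_submatrix e₇ rfl fun a ha => (h₇.mem a ha).2.1).mono
    (T' := I.n * (7 * I.n + 7) + 5 * I.n + 6) (by gcongr) fun _ _ h => h).seq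
    fun s₈ f₈ h₈ => ?_
  have e₈ := e₇.frame f₈
  have hk₈ : s₈.reg 1 = I.k := by
    rw [f₈.1 1 (by decide), f₇.1 1 (by decide), f₆.1 1 (by decide), f₅.1 1 (by decide),
      f₄.1 1 (by decide), f₃.1 1 (by decide), f₂.1 1 (by decide), f₁.1 1 (by decide), hr1]
  refine (reaches_finish e₈.reg2 e₈.reg3).mono le_rfl fun s₉ f₉ h₉ => ?_
  rw [hk₈, f₈.1 22 (by decide), f₈.1 23 (by decide)] at h₉
  have hmem : I ∈ StorageCapacityProblem q ↔
      (I.k : ℝ) ≤ s₇.reg 23 + storageCapacity q (I.graph.comap e) := by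
    rw [← hcap]
    rfl
  obtain ⟨h90, ⟨hn, hk, hyes⟩ | ⟨hn, hk, hlt, hle⟩⟩ := h₉
  · refine ⟨⟨0, ⊥, 0⟩, ⟨hn, hk, fun i => i.elim0⟩, iff_of_true ?_ ?_, Nat.zero_le _, Nat.zero_le _,
      Nat.zero_le _⟩
    -- If `m + 3 > 3k'`, then `m ≤ 3c` forces `c ≥ k'`: the rounding up of `m / 3` is what saves the
    -- `3` in the bound.
    · have : I.k ≤ s₇.reg 23 + c := by omega
      have : (I.k : ℝ) ≤ s₇.reg 23 + c := by exact_mod_cast this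
      rw [hmem]
      linarith
    · simpa [StorageCapacityProblem] using storageCapacity_nonneg hq (⊥ : SimpleGraph (Fin 0))
  · refine ⟨⟨s₇.reg 22, I.graph.comap e, I.k - s₇.reg 23⟩, ⟨hn, hk, fun a b => ?_⟩, ?_, hmn,
      Nat.sub_le _ _, ?_⟩
    · have := hM (e a) (e b)
      rw [he, he] at this
      rw [h90, h₈ a a.2 b b.2, this]
      rfl
    · rw [hmem]
      simp only [StorageCapacityProblem, Set.mem_ofPred_eq]
      rw [Nat.cast_sub hlt.le, sub_le_iff_le_add']
    · simp only
      omega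

/-- `kernelSteps` as a polynomial. -/
noncomputable def kernelPolynomial : Polynomial ℕ :=
  let X : Polynomial ℕ := Polynomial.X
  1 + (1 + (5 * X + 4 + (4 * (X * X) + 2 + ((X * (X + 1) + 1) * (X * (14 * X + 22) + 4) + 2 +
    ((X + 1) * (9 * X + 8) + 2 + (20 * X + 4 + (X * (7 * X + 7) + 5 * X + 6 + 15)))))))

theorem eval_kernelPolynomial (n : ℕ) : kernelPolynomial.eval n = kernelSteps n := by
  simp [kernelPolynomial, kernelSteps]

theorem kernelSteps_mono : Monotone kernelSteps := fun m n h => by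
  unfold kernelSteps
  gcongr

end StorageKernel

theorem theorem1p1 (q : ℕ) (hq : 2 ≤ q) :
    ∃ (P : StorageKernel.Prog)
      (f : StorageKernel.GraphInstance → StorageKernel.GraphInstance),
      StorageKernel.IsKernelization (StorageKernel.StorageCapacityProblem q) P f ∧
      ∀ I : StorageKernel.GraphInstance,
        ((f I).n : ℤ) ≤ max (3 * ((f I).k : ℤ) - 3) 0 ∧ (f I).k ≤ I.k := by
  -- The map `f` is obtained by choosing, for each input, an instance represented by the final
  -- state. The summand `X` of the polynomial pays for the output, which is no longer than the
  -- input, and `h` is `(3k)² + k`.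
  choose t ht s hexec f hrep hiff hn hk hbound using StorageKernel.reaches_kernel hq
  refine ⟨StorageKernel.kernel, f, ⟨⟨StorageKernel.kernelPolynomial + Polynomial.X, fun I =>
    ⟨t I, s I, hexec I, hrep I, ?_⟩⟩, hiff, fun k => (3 * k) * (3 * k) + k, ?_, fun I => ?_⟩,
    fun I => ⟨?_, hk I⟩⟩
  · rw [Polynomial.eval_add, Polynomial.eval_X, StorageKernel.eval_kernelPolynomial]
    refine add_le_add ((ht I).trans (StorageKernel.kernelSteps_mono ?_))
      (add_le_add (Nat.pow_le_pow_left (hn I) 2) (Nat.size_le_size (hk I)))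
    exact (Nat.le_self_pow two_ne_zero I.n).trans (Nat.le_add_right _ _)
  · have h3 : Primrec fun k : ℕ => 3 * k := Primrec.nat_mul.comp (.const 3) .id
    exact (Primrec.nat_add.comp (Primrec.nat_mul.comp h3 h3) .id).to_comp
  · have h1 := hbound I
    have h2 := hk I
    refine ⟨?_, h2.trans (Nat.le_add_left _ _)⟩
    have : (f I).n ≤ 3 * I.k := by omega
    rw [StorageKernel.GraphInstance.graphSize, sq]
    exact (Nat.mul_le_mul this this).trans (Nat.le_add_right _ _)
  · have := hbound I
    omega
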